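/- **Setting.** Consider an episodic MDP with state set $\mathcal S$, finite non-empty action set $\mathcal A$, horizon $H$, initial state distribution $\mu$, true transition model $M^\star$ and reward function $R^\star:\mathcal S\to[0,1]$; all distributions over states are discrete. A model $M$ maps each $(s,a)$ to a distribution $P_M(\cdot\mid s,a)$ over next states. For a (possibly randomized and time-dependent) Markov policy $\pi$, let $P_M^{\pi,h}$ be the law of the state at time $h$ when $s_0\sim\mu$, actions are drawn from $\pi$ and transitions from $M$. Put $v_M(\pi)=\sum_{h=1}^H\sum_s P_M^{\pi,h}(s)R^\star(s)$. Let $\mathcal M$ be a finite set of models and $\Pi$ a finite set of policies. For $1\le h\le H$ let $$\mathcal D(\pi,M,M',h)=\frac1{|\mathcal A|}\sum_{s,a,s'}\big|P_M(s'|s,a)P_M^{\pi,h-1}(s)-P_{M'}(s'|s,a)P_{M'}^{\pi,h-1}(s)\big|,$$ $$\mathcal W(\pi,M,h)=\mathbb E_{s\sim P^{\pi,h-1}_{M^\star},\,a\sim U(\mathcal A)}\big\|P_M(\cdot|s,a)-P_{M^\star}(\cdot|s,a)\big\|_{1}.$$ For a real matrix $B$, let $\mathrm{rank}(B,\beta)$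 be the least $k$ such that $B=UV^\top$ with $k$ columns in $U$ and $V$ and $\|u_i\|_2\|v_j\|_2\le\beta$ for all rows $u_i$ of $U$ and $v_j$ of $V$. Let $d=\max_{1\le h\le H}\mathrm{rank}(A_h,\beta)$, assumed finite, where $A_h=(\mathcal W(\pi,M,h))_{\pi\in\Pi,M\in\mathcal M}$ are the model misfit matrices. **Algorithm (DREEM with parameters $n,\epsilon,\phi$).** Start with $\mathcal M_1=\mathcal M$. In round $t$ let $\pi_t$ maximize $v_{\mathrm{explore}}(\pi,\mathcal M_t)=\max_{M,M'\in\mathcal M_t}\sum_{h=1}^H\mathcal D(\pi,M,M',h)$ over $\pi\in\Pi$. If $v_{\mathrm{explore}}(\pi_t,\mathcal M_t)>\epsilon/|\mathcal A|$, collect $n$ fresh independent trajectories with $\pi_t$; the $i$-th one supplies, for every $h\le H$, a triple $(s^{(i)}_{h-1},a^{(i)}_{h-1},s^{(i)}_h)$ with $s^{(i)}_{h-1}\sim P^{\pi_t,h-1}_{M^\star}$, $a^{(i)}_{h-1}\sim U(\mathcal A)$, $s^{(i)}_h\sim P_{M^\star}(\cdot|s^{(i)}_{h-1},a^{(i)}_{h-1})$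 (with an arbitrary joint law over different $h$). Set $\mathcal M_{t+1}=\{M\in\mathcal M_t:\widetilde{\mathcal W}(M,h)\le\phi\ \forall h\le H\}$, where $$\widetilde{\mathcal W}(M,h)=\max_{f\in\widetilde{\mathcal F}}\frac1n\sum_{i=1}^n\Big[\mathbb E_{s'\sim P_M(\cdot|s^{(i)}_{h-1},a^{(i)}_{h-1})}f(s^{(i)}_{h-1},a^{(i)}_{h-1},s')-f(s^{(i)}_{h-1},a^{(i)}_{h-1},s^{(i)}_h)\Big].$$ Here $\widetilde{\mathcal F}=\{\pm f_{\pi,M,h}:\pi\in\Pi,M\in\mathcal M,h\le H\}$, and $f_{\pi,M,h}$ is any maximizer of $\mathbb E_{s\sim P^{\pi,h-1}_{M^\star},a\sim U(\mathcal A)}\big[\mathbb E_{s'\sim P_M(\cdot|s,a)}f(s,a,s')-\mathbb E_{s'\sim P_{M^\star}(\cdot|s,a)}f(s,a,s')\big]$ over all $f$ with $\|f\|_\infty\le1$. Otherwise choose any $\tilde M\in\mathcal M_t$, halt and return a maximizer of $v_{\tilde M}$ over $\Pi$. All maximizations over $\Pi$ are exact, with arbitrary tie-breaking. **Theorem.**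 There is a universal constant $c>0$ such that for every $C\ge c$ there is a constant $C'>0$, depending only on $C$, with the following property. Assume $M^\star\in\mathcal M$ and that $\Pi$ contains an optimal policy for every model in $\mathcal M$. Let $\epsilon,\delta\in(0,1]$, $$\phi=\frac{\epsilon}{24H^2|\mathcal A|^2\sqrt d},\qquad T=\frac{Hd\log(\beta/(2\phi))}{\log(5/3)},$$ suppose $T>0$, and run DREEM with an integer $n=\Theta\big(H^4|\mathcal A|^4d\,\log(T|\mathcal M||\Pi|/\delta)/\epsilon^2\big)$, precisely $$c\,\frac{H^4|\mathcal A|^4d\log(T|\mathcal M||\Pi|/\delta)}{\epsilon^2}\le n\le C\,\frac{H^4|\mathcal A|^4d\log(T|\mathcal M||\Pi|/\delta)}{\epsilon^2}.$$ Then with probability at least $1-\delta$ the algorithm halts and returns a policy $\hat\pi$ with $v_{M^\star}(\hat\pi)\ge\max_\pi v_{M^\star}(\pi)-\epsilon$, and the total number of trajectories collected is at most $$C'\,\frac{H^5d^2|\mathcal A|^4}{\epsilon^2}\,\log\Big(\frac{T|\mathcal M||\Pi|}{\delta}\Big)\log\Big(\frac{\beta}{2\phi}\Big)=\tilde O\Big(\frac{H^5d^2|\mathcal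 A|^4}{\epsilon^2}\log\frac{T|\mathcal M||\Pi|}{\delta}\Big).$$ -/

import Mathlib

namespace DREEM

noncomputable section

universe u v

/-- A transition model: state-action pairs are mapped to distributions over next states. -/
abbrev Model (S : Type u) (A : Type v) := S → A → PMF S

/-- A (possibly time-dependent) randomized Markov policy: at time `h` in state `s` the action is
drawn from `π h s`. -/
abbrev Policy (S : Type u) (A : Type v) := ℕ → S → PMF A

/-- The environment: initial state distribution, true transition model, known reward function
with values in `[0, 1]`. -/
structure Env (S : Type u) (A : Type v) where
  init : PMF S
  Mstar : Model S A
  R : S → ℝ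
  R_nonneg : ∀ s, 0 ≤ R s
  R_le_one : ∀ s, R s ≤ 1

/-- What one trajectory contributes to the estimates: for every step `h`, a triple
(state at time `h`, action, state at time `h + 1`). -/
abbrev Trajectory (S : Type u) (A : Type v) (H : ℕ) := Fin H → S × A × S

/-- A data set of `n` trajectories. -/
abbrev Dataset (S : Type u) (A : Type v) (H n : ℕ) := Fin n → Trajectory S A H

/-- The replay buffer: the data sets collected so far with the policies that collected them,
most recent first. -/
abbrev Buffer (S : Type u) (A : Type v) (H n : ℕ) := List (Policy S A × Dataset S A H n)

/-- The `ℓ¹` distance `∑ₓ |p x - q x|`, which is the supremum of `E_p f - E_q f` over `|f| ≤ 1`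
(the normalization of total variation used throughout). -/
def tvDist {α : Type*} (p q : PMF α) : ℝ := ∑' x, |(p x).toReal - (q x).toReal|

/-- `n` independent draws from `p`. -/
def iid {α : Type*} (p : PMF α) : (n : ℕ) → PMF (Fin n → α)
  | 0 => PMF.pure Fin.elim0
  | n + 1 => p.bind fun x => (iid p n).bind fun y => PMF.pure (Fin.cons x y)

section Setting

variable {S : Type u} {A : Type v} [Fintype A] [Nonempty A]

/-- Distribution of the state at time `h` when actions are drawn from `π` and transitions from
`M`; time `0` is the initial state. -/
def stateDist (E : Env S A) (M : Model S A) (π : Policy S A) : ℕ → PMF S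
  | 0 => E.init
  | h + 1 => (stateDist E M π h).bind fun s => (π h s).bind fun a => M s a

/-- Expected total reward of `π` under the model `M`, over times `1, …, H`. -/
def value (E : Env S A) (H : ℕ) (M : Model S A) (π : Policy S A) : ℝ :=
  ∑ h ∈ Finset.range H, ∑' s, (stateDist E M π (h + 1) s).toReal * E.R s

/-- `π` is optimal for the model `M`. -/
def IsOptimal (E : Env S A) (H : ℕ) (M : Model S A) (π : Policy S A) : Prop :=
  ∀ π' : Policy S A, value E H M π' ≤ value E H M π

/-- Predicted disagreement between `M` and `M'` on the transition from time `h` to time `h + 1`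
(time step `h + 1` when steps are numbered from `1`), the last action being uniform. -/
def disagreement (E : Env S A) (π : Policy S A) (M M' : Model S A) (h : ℕ) : ℝ :=
  ∑' s, ∑ a, ∑' s',
    |(M s a s').toReal * (stateDist E M π h s).toReal * (Fintype.card A : ℝ)⁻¹
      - (M' s a s').toReal * (stateDist E M' π h s).toReal * (Fintype.card A : ℝ)⁻¹|

/-- Objective of the exploration policy: the maximal total disagreement over pairs of models. -/
def vExplore (E : Env S A) (H : ℕ) (π : Policy S A) (N : Finset (Model S A)) : ℝ :=
  ⨆ p : N × N, ∑ h ∈ Finset.range H, disagreement E π p.1.1 p.2.1 h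

/-- Misfit of `M` discovered by `π` on the transition from time `h` to time `h + 1`. -/
def misfit (E : Env S A) (π : Policy S A) (M : Model S A) (h : ℕ) : ℝ :=
  ∑' s, (stateDist E E.Mstar π h s).toReal *
    ∑ a, (Fintype.card A : ℝ)⁻¹ * tvDist (M s a) (E.Mstar s a)

/-- The model misfit matrix of step `h`. -/
def misfitMatrix (E : Env S A) (Pi : Finset (Policy S A)) (Ms : Finset (Model S A)) (h : ℕ) :
    Matrix Pi Ms ℝ :=
  Matrix.of fun π M => misfit E π.1 M.1 h

/-- `B = U Vᵀ` with inner dimension `k`, and `‖uᵢ‖ ‖vⱼ‖ ≤ β` for all pairs of rows. -/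
def HasFactorization {m n : Type*} (B : Matrix m n ℝ) (β : ℝ) (k : ℕ) : Prop :=
  ∃ (U : m → EuclideanSpace ℝ (Fin k)) (V : n → EuclideanSpace ℝ (Fin k)),
    (∀ i j, B i j = inner ℝ (U i) (V j)) ∧ ∀ i j, ‖U i‖ * ‖V j‖ ≤ β

/-- The norm-constrained rank `rank(B, β)`: the least inner dimension of such a factorization,
and `⊤` if there is none. -/
def normRank {m n : Type*} (B : Matrix m n ℝ) (β : ℝ) : ℕ∞ :=
  ⨅ (k : ℕ) (_ : HasFactorization B β k), (k : ℕ∞)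

/-- The law of a sample for step `h`: roll in with `π` in the true environment up to time `h`,
take a uniformly random action, observe the next state. -/
def sampleLaw (E : Env S A) (π : Policy S A) (h : ℕ) : PMF (S × A × S) :=
  (stateDist E E.Mstar π h).bind fun s =>
    (PMF.uniformOfFintype A).bind fun a => (E.Mstar s a).map fun s' => (s, a, s')

/-- `τ π` is an admissible law for a trajectory collected with `π`: for every step `h` its sample
has the law `sampleLaw E π h`. The joint law over different steps is left free. -/
def IsTrajectoryLaw (E : Env S A) (H : ℕ) (τ : Policy S A → PMF (Trajectory S A H)) : Prop :=
  ∀ (π : Policy S A) (h : Fin H), (τ π).map (fun x => x h) = sampleLaw E π h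

/-- `E_{s, a} [ E_{s' ∼ M(s,a)} f(s,a,s') - E_{s' ∼ M⋆(s,a)} f(s,a,s') ]` for `s` the state at
time `h` under `π` in the true environment and `a` uniform. -/
def testGap (E : Env S A) (π : Policy S A) (M : Model S A) (h : ℕ) (f : S × A × S → ℝ) : ℝ :=
  ∑' s, (stateDist E E.Mstar π h s).toReal * ∑ a, (Fintype.card A : ℝ)⁻¹ *
    ((∑' s', (M s a s').toReal * f (s, a, s')) - ∑' s', (E.Mstar s a s').toReal * f (s, a, s'))

/-- `F π M h` maximizes `testGap` among all functions with sup norm at most `1`. -/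
def IsTestFamily (E : Env S A) (H : ℕ) (Pi : Finset (Policy S A)) (Ms : Finset (Model S A))
    (F : Policy S A → Model S A → Fin H → S × A × S → ℝ) : Prop :=
  ∀ π ∈ Pi, ∀ M ∈ Ms, ∀ h : Fin H, (∀ x, |F π M h x| ≤ 1) ∧
    ∀ f : S × A × S → ℝ, (∀ x, |f x| ≤ 1) → testGap E π M h f ≤ testGap E π M h (F π M h)

/-- The finite set of test functions `± F π M h`. -/
def testSet {H : ℕ} (Pi : Finset (Policy S A)) (Ms : Finset (Model S A))
    (F : Policy S A → Model S A → Fin H → S × A × S → ℝ) : Set (S × A × S → ℝ) :=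
  {f | ∃ π ∈ Pi, ∃ M ∈ Ms, ∃ h : Fin H, f = F π M h ∨ f = -F π M h}

/-- Empirical misfit of `M` at step `h` computed from a data set with the test functions `Ft`. -/
def empMisfit {H n : ℕ} (Ft : Set (S × A × S → ℝ)) (D : Dataset S A H n) (M : Model S A)
    (h : Fin H) : ℝ :=
  sSup ((fun f : S × A × S → ℝ => (n : ℝ)⁻¹ * ∑ i : Fin n,
    ((∑' s', (M (D i h).1 (D i h).2.1 s').toReal * f ((D i h).1, (D i h).2.1, s'))
      - f (D i h))) '' Ft)

open Classical in
/-- The elimination step: keep the models with empirical misfit at most `φ` at every step. -/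
def updateModelSet {H n : ℕ} (Ft : Set (S × A × S → ℝ)) (φ : ℝ) (N : Finset (Model S A))
    (D : Dataset S A H n) : Finset (Model S A) :=
  N.filter fun M => ∀ h : Fin H, empMisfit Ft D M h ≤ φ

/-- The choices made by the algorithm; ties may be broken using the whole replay buffer. -/
structure Planner (S : Type u) (A : Type v) (H n : ℕ) where
  explore : Buffer S A H n → Finset (Model S A) → Policy S A
  choose : Buffer S A H n → Finset (Model S A) → Model S A
  exploit : Buffer S A H n → Model S A → Policy S A

/-- The policy optimizations are exact, and the chosen model belongs to the current model set. -/
structure Planner.IsExact {H n : ℕ} (P : Planner S A H n) (E : Env S A)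
    (Pi : Finset (Policy S A)) (Ms : Finset (Model S A)) : Prop where
  explore_mem : ∀ b, ∀ N ⊆ Ms, N.Nonempty → P.explore b N ∈ Pi
  explore_max : ∀ b, ∀ N ⊆ Ms, N.Nonempty → ∀ π ∈ Pi,
    vExplore E H π N ≤ vExplore E H (P.explore b N) N
  choose_mem : ∀ b, ∀ N ⊆ Ms, N.Nonempty → P.choose b N ∈ N
  exploit_mem : ∀ b, ∀ M ∈ Ms, P.exploit b M ∈ Pi
  exploit_max : ∀ b, ∀ M ∈ Ms, ∀ π ∈ Pi, value E H M π ≤ value E H M (P.exploit b M)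

/-- State of the algorithm between two iterations of its main loop: still running, with its
replay buffer and current model set, or halted, with its final buffer and output policy. -/
inductive State (S : Type u) (A : Type v) (H n : ℕ) where
  | running (b : Buffer S A H n) (N : Finset (Model S A))
  | halted (b : Buffer S A H n) (π : Policy S A)

open Classical in
/-- One iteration of the main loop. If the model set has become empty, no model can be chosen and
the algorithm never produces an output. -/
def step {H n : ℕ} (E : Env S A) (τ : Policy S A → PMF (Trajectory S A H))
    (Ft : Set (S × A × S → ℝ)) (P : Planner S A H n) (ε φ : ℝ) :
    State S A H n → PMF (State S A H n)
  | .halted b π => PMF.pure (.halted b π)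
  | .running b N =>
    if N.Nonempty then
      if ε / (Fintype.card A : ℝ) < vExplore E H (P.explore b N) N then
        (iid (τ (P.explore b N)) n).map fun D =>
          .running ((P.explore b N, D) :: b) (updateModelSet Ft φ N D)
      else PMF.pure (.halted b (P.exploit b (P.choose b N)))
    else PMF.pure (.running b N)

/-- The law of the state after `k` iterations, started with the model set `Ms` and an empty
replay buffer. -/
def run {H n : ℕ} (E : Env S A) (τ : Policy S A → PMF (Trajectory S A H))
    (Ft : Set (S × A × S → ℝ)) (P : Planner S A H n) (ε φ : ℝ) (Ms : Finset (Model S A)) :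
    ℕ → PMF (State S A H n)
  | 0 => PMF.pure (.running [] Ms)
  | k + 1 => (run E τ Ft P ε φ Ms k).bind (step E τ Ft P ε φ)

/-- The probability that the algorithm halts with a final replay buffer and an output policy that
satisfy `G`. Halted states are absorbing, so the supremum over the number of iterations is the
limit. -/
def haltProb {H n : ℕ} (E : Env S A) (τ : Policy S A → PMF (Trajectory S A H))
    (Ft : Set (S × A × S → ℝ)) (P : Planner S A H n) (ε φ : ℝ) (Ms : Finset (Model S A))
    (G : Buffer S A H n → Policy S A → Prop) : ENNReal :=
  ⨆ k : ℕ, (run E τ Ft P ε φ Ms k).toOuterMeasure {x | ∃ b π, x = .halted b π ∧ G b π}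

/-- Number of trajectories in the replay buffer: `n` for every data set. -/
def numTrajectories {H n : ℕ} (b : Buffer S A H n) : ℕ := n * b.length

end Setting

/-- The threshold `φ = ε / (24 H² |𝒜|² √d)`. -/
def threshold (H a d : ℕ) (ε : ℝ) : ℝ := ε / (24 * (H : ℝ) ^ 2 * (a : ℝ) ^ 2 * √(d : ℝ))

/-- `T = H d log(β / (2φ)) / log(5/3)`. -/
def roundBound (H a d : ℕ) (ε β : ℝ) : ℝ :=
  (H : ℝ) * d * Real.log (β / (2 * threshold H a d ε)) / Real.log (5 / 3)

end

end DREEM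

/-! ### Ellipsoids under deep cuts -/

namespace DREEM

open Matrix

/-! Each exploration round finds a large entry of a misfit matrix in a column whose entries in all
earlier explored rows are small, and a matrix of small norm-constrained rank admits few such entries
in succession.

In detail, a simulation argument bounds the disagreement of a model with the truth by its misfits
(`sum_disagreement_le`). Hence an objective above `ε / |𝒜|` forces a surviving model with misfit
above `ε / (2 H² |𝒜|²)`, which is `6 η √d` for `η = 2 φ` (`exists_lt_misfit`). If the data are
accurate to within `φ`, the elimination step keeps the truth and leaves only models with misfit at
most `η` under the explored policy (`Mstar_mem_updateModelSet`, `misfit_le_of_mem_updateModelSet`).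

Factor the misfit as an inner product `⟨u_π, v_M⟩`. For a fixed step, the surviving vectors `v_M`
lie in an ellipsoid intersected with slabs `|⟨u_π, v⟩| ≤ η`, and a new witness says that the
ellipsoid is much wider than the next slab. Such a cut can be enclosed in an ellipsoid of at most
half the volume (`exists_posDef_of_cut`). The trace of the defining matrix stays bounded, so its
determinant does too, and the volume cannot shrink for ever (`length_cuts_le`). Summing over the `H`
steps gives at most `T` rounds (`IsHistory.length_le`).

When exploration stops, any two surviving models, the truth among them, give every policy in the
class values within `ε / 2` of each other, so the returned policy is `ε`-optimal
(`value_sub_le_of_vExplore_le`). Hoeffding's inequality and a union bound control one data set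
(`toOuterMeasure_not_isAccurate_le`). An invariant of the Markov chain of algorithm states adds up
the failure probabilities over at most `T + 1` iterations (`one_sub_le_haltProb`). -/

theorem det_le_pow_trace_div {k : ℕ} (hk : 0 < k) {Q : Matrix (Fin k) (Fin k) ℝ}
    (hQ : Q.PosDef) : Q.det ≤ (Q.trace / k) ^ k := by
  have hk' : (k : ℝ) ≠ 0 := by positivity
  -- AM-GM for the eigenvalues, whose product is the determinant and whose sum is the trace.
  have hnn : ∀ i, 0 ≤ hQ.isHermitian.eigenvalues i := fun i => (hQ.eigenvalues_pos i).le
  have h := Real.geom_mean_le_arith_mean Finset.univ (fun _ : Fin k => (1 : ℝ))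
    hQ.isHermitian.eigenvalues (fun _ _ => zero_le_one) (by simpa using hk) (fun i _ => hnn i)
  simp only [Real.rpow_one, Finset.sum_const, Finset.card_univ, Fintype.card_fin, nsmul_eq_mul,
    mul_one, one_mul] at h
  have hdet : Q.det = ∏ i, hQ.isHermitian.eigenvalues i := by
    simpa using hQ.isHermitian.det_eq_prod_eigenvalues
  have htr : Q.trace = ∑ i, hQ.isHermitian.eigenvalues i := by
    simpa using hQ.isHermitian.trace_eq_sum_eigenvalues
  rw [← hdet, ← htr] at h
  have hd : 0 ≤ Q.det := hQ.det_pos.le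
  calc Q.det = (Q.det ^ ((k : ℝ)⁻¹)) ^ k := by
        rw [← Real.rpow_natCast, ← Real.rpow_mul hd, inv_mul_cancel₀ hk', Real.rpow_one]
    _ ≤ _ := by gcongr

/-- Cauchy-Schwarz for the inner product defined by `Q`, applied to `Q⁻¹ u` and `v`. It turns a
point of the ellipsoid far out in direction `u` into a lower bound on the width `uᵀ Q⁻¹ u`. -/
theorem sq_dotProduct_le_of_posDef {k : ℕ} {Q : Matrix (Fin k) (Fin k) ℝ} (hQ : Q.PosDef)
    (u v : Fin k → ℝ) (hv : v ⬝ᵥ Q *ᵥ v ≤ 1) : (u ⬝ᵥ v) ^ 2 ≤ u ⬝ᵥ Q⁻¹ *ᵥ u := by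
  have hu : Q *ᵥ (Q⁻¹ *ᵥ u) = u := by
    rw [mulVec_mulVec, mul_nonsing_inv _ hQ.det_pos.ne'.isUnit, one_mulVec]
  set y := Q⁻¹ *ᵥ u with hy
  set s := u ⬝ᵥ v
  have hsym : y ⬝ᵥ Q *ᵥ v = s := by
    have hT : Qᵀ = Q := by simpa using hQ.isHermitian.eq
    rw [dotProduct_mulVec, ← mulVec_transpose, hT, hu]
  have h0 := hQ.posSemidef.dotProduct_mulVec_nonneg (y - s • v)
  have hvu : v ⬝ᵥ u = s := dotProduct_comm _ _
  have hyu : y ⬝ᵥ u = u ⬝ᵥ y := dotProduct_comm _ _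
  simp only [star_trivial, mulVec_sub, mulVec_smul, sub_dotProduct, dotProduct_sub,
    smul_dotProduct, dotProduct_smul, smul_eq_mul, hu, hsym, hvu, hyu] at h0
  nlinarith [mul_le_mul_of_nonneg_left hv (sq_nonneg s)]

theorem det_add_smul_vecMulVec {k : ℕ} {Q : Matrix (Fin k) (Fin k) ℝ} (hQ : IsUnit Q.det)
    (u : Fin k → ℝ) (r : ℝ) :
    (Q + r • vecMulVec u u).det = Q.det * (1 + r * (u ⬝ᵥ Q⁻¹ *ᵥ u)) := by
  have h := det_add_replicateCol_mul_replicateRow (ι := Unit) hQ (r • u) u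
  rw [← vecMulVec_eq, smul_vecMulVec] at h
  rw [h]
  congr 1
  rw [det_unique, Matrix.add_apply, one_apply_eq, Matrix.mul_assoc]
  congr 1
  simp only [Matrix.mul_apply, replicateRow_apply, replicateCol_apply, dotProduct, mulVec,
    Pi.smul_apply, smul_eq_mul, Finset.mul_sum]
  refine Finset.sum_congr rfl fun i _ => Finset.sum_congr rfl fun j _ => ?_
  ring

/-- Cutting the ellipsoid `{v | vᵀ Q v ≤ 1}` by a slab that is thin compared to the width of the
ellipsoid: the intersection is contained in an ellipsoid with a much larger determinant. -/
theorem exists_posDef_of_cut {k d : ℕ} (hkd : k ≤ d) {η t : ℝ} (hη : 0 < η)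
    {Q : Matrix (Fin k) (Fin k) ℝ} (hQ : Q.PosDef) {u v : Fin k → ℝ} (hv : v ⬝ᵥ Q *ᵥ v ≤ 1)
    (huv : 6 * η * √d < u ⬝ᵥ v) (ht : Q.trace ≤ t) (hu : u ⬝ᵥ u / η ^ 2 ≤ t) :
    ∃ Q' : Matrix (Fin k) (Fin k) ℝ, Q'.PosDef ∧ Q'.trace ≤ t ∧ 4 * Q.det ≤ Q'.det ∧
      ∀ x : Fin k → ℝ, x ⬝ᵥ Q *ᵥ x ≤ 1 → |u ⬝ᵥ x| ≤ η → x ⬝ᵥ Q' *ᵥ x ≤ 1 := by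
  set w := u ⬝ᵥ Q⁻¹ *ᵥ u with hw
  have hw1 : 36 * η ^ 2 * d < w := by
    have h1 := sq_dotProduct_le_of_posDef hQ u v hv
    have h2 : (6 * η * √d) ^ 2 < (u ⬝ᵥ v) ^ 2 := by
      apply pow_lt_pow_left₀ huv (by positivity) two_ne_zero
    have h3 : (6 * η * √d) ^ 2 = 36 * η ^ 2 * d := by
      rw [mul_pow, Real.sq_sqrt (Nat.cast_nonneg d)]; ring
    linarith
  have hwpos : 0 < w := lt_of_le_of_lt (by positivity) hw1
  -- The new matrix is `Q + (4 / w) u uᵀ`, rescaled. The coefficient `4 / w` makes the rank-one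
  -- update multiply the determinant by `1 + 4`, and `q` is the most that the added term contributes
  -- on the slab, so dividing by `1 + q` restores the bound `1`.
  set q := 4 * η ^ 2 / w with hq
  have hqpos : 0 < q := by positivity
  have hq4 : 4 / w = q / η ^ 2 := by rw [hq]; field_simp
  have hkq : k * q ≤ 1 / 9 := by
    have : (k : ℝ) ≤ d := by exact_mod_cast hkd
    rw [hq, mul_div_assoc', div_le_div_iff₀ hwpos (by norm_num)]
    nlinarith [mul_le_mul_of_nonneg_left this (sq_nonneg η)]
  -- The rescaling costs a factor `(1 + q) ^ k` in the determinant. The constant 6 in the width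
  -- makes it at most `exp (1 / 9)`, and the net gain is at least `5 / (5 / 4) = 4`.
  have hpow : (1 + q) ^ k ≤ 5 / 4 := by
    calc (1 + q) ^ k ≤ (Real.exp q) ^ k := by
          gcongr; linarith [Real.add_one_le_exp q]
      _ = Real.exp (k * q) := by rw [← Real.exp_nat_mul]
      _ ≤ Real.exp (1 / 9) := Real.exp_le_exp.2 hkq
      _ ≤ 5 / 4 := by
          have h1 := Real.add_one_le_exp (-(1 / 9 : ℝ))
          have h2 : Real.exp (1 / 9) * Real.exp (-(1 / 9)) = 1 := by
            rw [← Real.exp_add]; simp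
          nlinarith [Real.exp_pos (1 / 9)]
  refine ⟨(1 + q)⁻¹ • (Q + (4 / w) • vecMulVec u u), ?_, ?_, ?_, ?_⟩
  · refine PosDef.smul (hQ.add_posSemidef (PosSemidef.smul ?_ (by positivity))) (by positivity)
    simpa using posSemidef_vecMulVec_self_star u
  -- The new trace is the mean of `Q.trace` and `u ⬝ᵥ u / η ^ 2` with weights `1 / (1 + q)` and `q /
  -- (1 + q)`, so the bound `t` persists through any number of cuts.
  · rw [trace_smul, trace_add, trace_smul, trace_vecMulVec, smul_eq_mul, smul_eq_mul, hq4,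
      inv_mul_le_iff₀ (by positivity)]
    have : q / η ^ 2 * (u ⬝ᵥ u) = q * (u ⬝ᵥ u / η ^ 2) := by ring
    rw [this]
    nlinarith [mul_le_mul_of_nonneg_left hu hqpos.le]
  · rw [det_smul, det_add_smul_vecMulVec hQ.det_pos.ne'.isUnit, ← hw, div_mul_cancel₀ _ hwpos.ne',
      Fintype.card_fin, inv_pow, ← div_eq_inv_mul, le_div_iff₀ (by positivity)]
    nlinarith [mul_le_mul_of_nonneg_left hpow hQ.det_pos.le]
  · intro x hx hux
    have h1 : (u ⬝ᵥ x) ^ 2 ≤ η ^ 2 := by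
      rw [← sq_abs]; gcongr
    have h2 : x ⬝ᵥ (vecMulVec u u) *ᵥ x = (u ⬝ᵥ x) ^ 2 := by
      rw [vecMulVec_mulVec, dotProduct_smul, dotProduct_comm x u]
      simp [sq]
    rw [smul_mulVec, dotProduct_smul, add_mulVec, dotProduct_add, smul_mulVec, dotProduct_smul,
      h2, smul_eq_mul, smul_eq_mul, hq4, inv_mul_le_iff₀ (by positivity)]
    have : q / η ^ 2 * (u ⬝ᵥ x) ^ 2 ≤ q := by
      rw [div_mul_eq_mul_div, div_le_iff₀ (by positivity)]
      gcongr
    linarith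

/-- The ellipsoid obtained after a sequence of deep cuts; the most recent cut is the head. -/
theorem exists_posDef_of_cuts {k d : ℕ} (hkd : k ≤ d) {η t R : ℝ} (hη : 0 < η) (hR : 0 < R)
    (htR : k / R ^ 2 ≤ t) (l : List ((Fin k → ℝ) × (Fin k → ℝ)))
    (hpair : l.Pairwise fun x y => |y.1 ⬝ᵥ x.2| ≤ η)
    (hwide : ∀ x ∈ l, 6 * η * √d < x.1 ⬝ᵥ x.2)
    (hu : ∀ x ∈ l, x.1 ⬝ᵥ x.1 / η ^ 2 ≤ t) (hv : ∀ x ∈ l, x.2 ⬝ᵥ x.2 ≤ R ^ 2) :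
    ∃ Q : Matrix (Fin k) (Fin k) ℝ, Q.PosDef ∧ Q.trace ≤ t ∧
      4 ^ l.length * ((R ^ 2)⁻¹) ^ k ≤ Q.det ∧
      ∀ v : Fin k → ℝ, v ⬝ᵥ v ≤ R ^ 2 → (∀ x ∈ l, |x.1 ⬝ᵥ v| ≤ η) → v ⬝ᵥ Q *ᵥ v ≤ 1 := by
  induction l with
  | nil =>
    -- Before any cut the ellipsoid is the ball of radius `R`.
    refine ⟨(R ^ 2)⁻¹ • 1, PosDef.smul PosDef.one (by positivity), ?_, ?_, ?_⟩
    · simpa [div_eq_inv_mul] using htR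
    · simp
    · intro v hv _
      rw [smul_mulVec, one_mulVec, dotProduct_smul, smul_eq_mul, inv_mul_le_iff₀ (by positivity)]
      simpa using hv
  | cons a l ih =>
    rw [List.pairwise_cons] at hpair
    simp only [List.mem_cons, forall_eq_or_imp] at hwide hu hv
    obtain ⟨Q, hQ, htr, hdet, hmem⟩ := ih hpair.2 hwide.2 hu.2 hv.2
    obtain ⟨Q', hQ', htr', hdet', hmem'⟩ := exists_posDef_of_cut hkd hη hQ
      (hmem a.2 hv.1 fun x hx => hpair.1 x hx) hwide.1 htr hu.1
    refine ⟨Q', hQ', htr', ?_, ?_⟩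
    · rw [List.length_cons, pow_succ]
      linarith
    · intro v hv' hl
      simp only [List.mem_cons, forall_eq_or_imp] at hl
      exact hmem' v (hmem v hv' hl.2) hl.1

/-- The number of deep cuts is at most `k log (B R / η) / log 2`. -/
theorem length_cuts_le {k d : ℕ} (hkd : k ≤ d) (hd : 0 < d) {η B R : ℝ} (hη : 0 < η)
    (hB : 0 ≤ B) (hR : 0 ≤ R)
    (l : List (EuclideanSpace ℝ (Fin k) × EuclideanSpace ℝ (Fin k)))
    (hpair : l.Pairwise fun x y => |inner ℝ y.1 x.2| ≤ η)
    (hwide : ∀ x ∈ l, 6 * η * √d < inner ℝ x.1 x.2)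
    (hu : ∀ x ∈ l, ‖x.1‖ ≤ B) (hv : ∀ x ∈ l, ‖x.2‖ ≤ R) (hl : l ≠ []) :
    η < B * R ∧ l.length * Real.log 2 ≤ k * Real.log (B * R / η) := by
  have hinner : ∀ x y : EuclideanSpace ℝ (Fin k), inner ℝ x y = x.ofLp ⬝ᵥ y.ofLp := by
    intro x y
    rw [EuclideanSpace.inner_eq_star_dotProduct, dotProduct_comm]; simp
  have hnorm : ∀ x : EuclideanSpace ℝ (Fin k), x.ofLp ⬝ᵥ x.ofLp = ‖x‖ ^ 2 := by
    intro x
    rw [← hinner, real_inner_self_eq_norm_sq]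
  obtain ⟨a, ha⟩ := List.exists_mem_of_ne_nil l hl
  have hd1 : 1 ≤ √(d : ℝ) := by
    rw [Real.one_le_sqrt]; exact_mod_cast hd
  have hBR : 6 * η < B * R := by
    calc 6 * η ≤ 6 * η * √d := le_mul_of_one_le_right (by positivity) hd1
      _ < inner ℝ a.1 a.2 := hwide a ha
      _ ≤ ‖a.1‖ * ‖a.2‖ := real_inner_le_norm _ _
      _ ≤ B * R := by gcongr <;> [exact hu a ha; exact hv a ha]
  have hBR' : η < B * R := by linarith
  have hR0 : 0 < R := by
    rcases hR.eq_or_lt with h | h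
    · rw [← h] at hBR; linarith
    · exact h
  have hk : 0 < k := by
    rcases Nat.eq_zero_or_pos k with h | h
    · subst h
      have h0 := hwide a ha
      rw [Subsingleton.elim a.1 0, inner_zero_left] at h0
      exact absurd h0 (not_lt.2 (by positivity))
    · exact h
  have hk1 : (1 : ℝ) ≤ k := by exact_mod_cast hk
  refine ⟨hBR', ?_⟩
  -- This `t` dominates the trace `k / R ^ 2` of the initial ball, because `η < B R`, and every `u
  -- ⬝ᵥ u / η ^ 2`. The factor `k` cancels in the AM-GM bound, leaving `Q.det ≤ (B / η) ^ (2 k)`.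
  obtain ⟨Q, hQ, htr, hdet, -⟩ := exists_posDef_of_cuts (R := R) (t := k * (B / η) ^ 2) hkd hη hR0
    (by
      rw [div_eq_mul_inv]
      gcongr
      rw [← inv_pow]
      gcongr
      rw [inv_eq_one_div, div_le_div_iff₀ hR0 hη]
      linarith)
    (l.map fun x => (x.1.ofLp, x.2.ofLp))
    (by
      rw [List.pairwise_map]
      exact hpair.imp fun {x y} h => by simpa only [hinner] using h)
    (by simpa only [List.forall_mem_map, hinner] using hwide)
    (by
      simp only [List.forall_mem_map, hnorm]
      intro x hx
      have : ‖x.1‖ ^ 2 ≤ B ^ 2 := by gcongr; exact hu x hx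
      rw [div_pow]
      calc ‖x.1‖ ^ 2 / η ^ 2 ≤ B ^ 2 / η ^ 2 := by gcongr
        _ ≤ _ := le_mul_of_one_le_left (by positivity) hk1)
    (by
      simp only [List.forall_mem_map, hnorm]
      intro x hx
      gcongr
      exact hv x hx)
  have h1 : Q.det ≤ ((B / η) ^ 2) ^ k := by
    refine (det_le_pow_trace_div hk hQ).trans ?_
    have := hQ.posSemidef.trace_nonneg
    gcongr
    rw [div_le_iff₀ (by positivity), mul_comm]
    exact htr
  have h2 : (4 : ℝ) ^ l.length ≤ ((B * R / η) ^ 2) ^ k := by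
    rw [List.length_map, inv_pow, ← div_eq_mul_inv, div_le_iff₀ (by positivity)] at hdet
    calc (4 : ℝ) ^ l.length ≤ Q.det * (R ^ 2) ^ k := hdet
      _ ≤ ((B / η) ^ 2) ^ k * (R ^ 2) ^ k := by gcongr
      _ = _ := by rw [← mul_pow, ← mul_pow]; congr 2; ring
  have h3 := Real.log_le_log (by positivity) h2
  rw [Real.log_pow, Real.log_pow, Real.log_pow, show (4 : ℝ) = 2 ^ 2 by norm_num,
    Real.log_pow] at h3
  push_cast at h3
  linarith

end DREEM

/-! ### Expectations and Hoeffding's inequality for discrete distributions -/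

namespace DREEM

open scoped ENNReal

theorem tsum_bind_mul {α β : Type*} (p : PMF α) (f : α → PMF β) (G : β → ℝ≥0∞) :
    ∑' y, p.bind f y * G y = ∑' x, p x * ∑' y, f x y * G y := by
  simp only [PMF.bind_apply, ← ENNReal.tsum_mul_right, ← ENNReal.tsum_mul_left]
  rw [ENNReal.tsum_comm]
  simp only [mul_assoc]

theorem tsum_pure_mul {α : Type*} (a : α) (G : α → ℝ≥0∞) : ∑' y, PMF.pure a y * G y = G a := by
  rw [tsum_eq_single a fun b hb => by simp [PMF.pure_apply, hb]]
  simp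

/-- Independence in the form needed for exponential moments: the expectation of a product over the
draws factorizes. -/
theorem tsum_iid_mul_prod {α : Type*} (p : PMF α) (G : α → ℝ≥0∞) (n : ℕ) :
    ∑' y, iid p n y * ∏ i, G (y i) = (∑' x, p x * G x) ^ n := by
  induction n with
  | zero =>
    simp only [iid, tsum_pure_mul, Finset.univ_eq_empty, Finset.prod_empty, pow_zero]
  | succ n ih =>
    simp only [iid, tsum_bind_mul, tsum_pure_mul, Fin.prod_univ_succ, Fin.cons_zero,
      Fin.cons_succ]
    simp only [mul_left_comm _ (G _), ENNReal.tsum_mul_left, ih]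
    rw [pow_succ', ← ENNReal.tsum_mul_right]
    refine tsum_congr fun x => ?_
    ring

/-- Markov's inequality, used with an exponential weight `W`. -/
theorem toOuterMeasure_le_tsum_mul {α : Type*} (p : PMF α) {s : Set α} {W : α → ℝ≥0∞}
    (h : ∀ x ∈ s, 1 ≤ W x) : p.toOuterMeasure s ≤ ∑' x, p x * W x := by
  rw [PMF.toOuterMeasure_apply]
  refine ENNReal.tsum_le_tsum fun x => ?_
  by_cases hx : x ∈ s
  · rw [Set.indicator_of_mem hx]
    exact le_mul_of_one_le_right (by simp) (h x hx)
  · simp [hx]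

theorem one_le_toOuterMeasure_add_compl {α : Type*} (p : PMF α) (s : Set α) :
    1 ≤ p.toOuterMeasure s + p.toOuterMeasure sᶜ := by
  have h : p.toOuterMeasure Set.univ = 1 :=
    (p.toOuterMeasure_apply_eq_one_iff _).2 (Set.subset_univ _)
  rw [← h, ← Set.union_compl_self s]
  exact MeasureTheory.measure_union_le _ _

/-- One step of a Markov chain increases the probability of having left a set by at most the
largest conditional probability of leaving it. -/
theorem toOuterMeasure_bind_compl_le {α β : Type*} (p : PMF α) (f : α → PMF β) (s : Set α)
    (t : Set β) (r : ℝ≥0∞) (h : ∀ x ∈ s, (f x).toOuterMeasure tᶜ ≤ r) :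
    (p.bind f).toOuterMeasure tᶜ ≤ p.toOuterMeasure sᶜ + r := by
  rw [PMF.toOuterMeasure_bind_apply, PMF.toOuterMeasure_apply]
  calc ∑' x, p x * (f x).toOuterMeasure tᶜ ≤ ∑' x, (sᶜ.indicator p x + p x * r) := by
        refine ENNReal.tsum_le_tsum fun x => ?_
        by_cases hx : x ∈ s
        · simpa [hx] using mul_le_mul_right (h x hx) (p x)
        · have h1 : (f x).toOuterMeasure tᶜ ≤ 1 := by
            rw [← ((f x).toOuterMeasure_apply_eq_one_iff _).2 (Set.subset_univ _)]
            exact MeasureTheory.measure_mono (Set.subset_univ _)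
          rw [Set.indicator_of_mem (by simpa using hx)]
          calc p x * (f x).toOuterMeasure tᶜ ≤ p x * 1 := by gcongr
            _ ≤ p x + p x * r := by simp
    _ = _ := by rw [ENNReal.tsum_add, ENNReal.tsum_mul_right, p.tsum_coe, one_mul]

/-- The expectation `E_p g`. -/
noncomputable def expectation {α : Type*} (p : PMF α) (g : α → ℝ) : ℝ := ∑' x, (p x).toReal * g x

theorem hasSum_toReal {α : Type*} (p : PMF α) : HasSum (fun x => (p x).toReal) 1 := by
  have h := (ENNReal.summable_toReal p.tsum_coe_ne_top).hasSum
  rwa [← ENNReal.tsum_toReal_eq p.apply_ne_top, p.tsum_coe, ENNReal.toReal_one] at h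

theorem summable_toReal_mul {α : Type*} (p : PMF α) {g : α → ℝ} {C : ℝ} (hg : ∀ x, |g x| ≤ C) :
    Summable fun x => (p x).toReal * g x := by
  refine Summable.of_norm_bounded ((hasSum_toReal p).summable.mul_right C) fun x => ?_
  rw [norm_mul, Real.norm_eq_abs, Real.norm_eq_abs, abs_of_nonneg ENNReal.toReal_nonneg]
  exact mul_le_mul_of_nonneg_left (hg x) ENNReal.toReal_nonneg

theorem abs_expectation_le {α : Type*} (p : PMF α) {g : α → ℝ} {C : ℝ} (hg : ∀ x, |g x| ≤ C) :
    |expectation p g| ≤ C := by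
  have h := ((hasSum_toReal p).mul_right C)
  rw [one_mul] at h
  rw [← Real.norm_eq_abs]
  refine tsum_of_norm_bounded h fun x => ?_
  rw [norm_mul, Real.norm_eq_abs, Real.norm_eq_abs, abs_of_nonneg ENNReal.toReal_nonneg]
  exact mul_le_mul_of_nonneg_left (hg x) ENNReal.toReal_nonneg

theorem expectation_pure {α : Type*} (a : α) (g : α → ℝ) : expectation (PMF.pure a) g = g a := by
  rw [expectation, tsum_eq_single a fun b hb => by simp [PMF.pure_apply, hb]]
  simp

theorem toReal_bind_apply {α β : Type*} (p : PMF α) (f : α → PMF β) (y : β) :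
    (p.bind f y).toReal = ∑' x, (p x).toReal * (f x y).toReal := by
  rw [PMF.bind_apply, ENNReal.tsum_toReal_eq]
  · simp only [ENNReal.toReal_mul]
  · exact fun x => ENNReal.mul_ne_top (p.apply_ne_top x) ((f x).apply_ne_top y)

theorem summable_toReal_mul_toReal {α β : Type*} (p : PMF α) (f : α → PMF β) :
    Summable fun x : α × β => (p x.1).toReal * (f x.1 x.2).toReal := by
  simp only [← ENNReal.toReal_mul]
  refine ENNReal.summable_toReal ?_
  rw [ENNReal.tsum_prod (f := fun x y => p x * f x y)]
  simp [ENNReal.tsum_mul_left, PMF.tsum_coe]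

theorem expectation_bind {α β : Type*} (p : PMF α) (f : α → PMF β) {g : β → ℝ} {C : ℝ}
    (hg : ∀ y, |g y| ≤ C) :
    expectation (p.bind f) g = expectation p fun x => expectation (f x) g := by
  have hs : Summable fun x : α × β => (p x.1).toReal * (f x.1 x.2).toReal * g x.2 := by
    refine Summable.of_norm_bounded ((summable_toReal_mul_toReal p f).mul_right C) fun x => ?_
    rw [norm_mul, norm_mul]
    simp only [Real.norm_eq_abs, abs_of_nonneg ENNReal.toReal_nonneg]
    exact mul_le_mul_of_nonneg_left (hg _) (by positivity)
  simp only [expectation, toReal_bind_apply, ← tsum_mul_right, ← tsum_mul_left, ← mul_assoc]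
  exact (Summable.tsum_comm (f := fun x y => (p x).toReal * (f x y).toReal * g y) hs)

theorem expectation_map {α β : Type*} (p : PMF α) (f : α → β) {g : β → ℝ} {C : ℝ}
    (hg : ∀ y, |g y| ≤ C) : expectation (p.map f) g = expectation p fun x => g (f x) := by
  rw [← PMF.bind_pure_comp, expectation_bind _ _ hg]
  simp only [Function.comp_apply, expectation_pure]

theorem expectation_uniformOfFintype {α : Type*} [Fintype α] [Nonempty α] (g : α → ℝ) :
    expectation (PMF.uniformOfFintype α) g = ∑ a, (Fintype.card α : ℝ)⁻¹ * g a := by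
  simp [expectation, tsum_fintype]

/-- Hoeffding's lemma for a bounded function under a discrete distribution. -/
theorem tsum_mul_exp_le {α : Type*} (p : PMF α) {X : α → ℝ} {C : ℝ} (hC : 0 ≤ C)
    (hX : ∀ x, |X x| ≤ C) (t : ℝ) :
    ∑' x, p x * ENNReal.ofReal (Real.exp (t * (X x - expectation p X))) ≤
      ENNReal.ofReal (Real.exp (C ^ 2 * t ^ 2 / 2)) := by
  -- With the discrete σ-algebra every function is measurable, so the sub-Gaussian bound for bounded
  -- variables applies, and its integrals are sums.
  let _ : MeasurableSpace α := ⊤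
  have hb : ∀ᵐ x ∂p.toMeasure, X x ∈ Set.Icc (-C) C :=
    Filter.Eventually.of_forall fun x => abs_le.1 (hX x)
  have hm : AEMeasurable X p.toMeasure := measurable_from_top.aemeasurable
  have hE : ∫ x, X x ∂p.toMeasure = expectation p X := by
    rw [PMF.integral_eq_tsum _ _ (MeasureTheory.Integrable.of_mem_Icc (-C) C hm hb)]
    simp [expectation]
  have hsub := ProbabilityTheory.hasSubgaussianMGF_of_mem_Icc hm hb
  have hint := hsub.integrable_exp_mul t
  have hmgf := hsub.mgf_le t
  rw [hE] at hint hmgf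
  rw [ProbabilityTheory.mgf, PMF.integral_eq_tsum _ _ hint] at hmgf
  have hc : (((‖C - -C‖₊ / 2) ^ 2 : NNReal) : ℝ) = C ^ 2 := by
    push_cast
    rw [Real.norm_eq_abs, abs_of_nonneg (by linarith)]
    ring
  rw [hc] at hmgf
  have hs : Summable fun x => (p x).toReal • Real.exp (t * (X x - expectation p X)) := by
    refine summable_toReal_mul p (C := Real.exp (|t| * (C + C))) fun x => ?_
    rw [Real.abs_exp, Real.exp_le_exp]
    refine (le_abs_self _).trans ?_
    rw [abs_mul]
    gcongr
    exact (abs_sub _ _).trans (add_le_add (hX x) (abs_expectation_le p hX))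
  refine le_trans (le_of_eq ?_) (ENNReal.ofReal_le_ofReal hmgf)
  rw [ENNReal.ofReal_tsum_of_nonneg (fun x => by positivity) hs]
  refine tsum_congr fun x => ?_
  rw [smul_eq_mul, ENNReal.ofReal_mul ENNReal.toReal_nonneg,
    ENNReal.ofReal_toReal (p.apply_ne_top x)]

/-- Hoeffding's inequality for `n` independent draws from a discrete distribution. -/
theorem toOuterMeasure_iid_le_exp {α : Type*} (p : PMF α) {X : α → ℝ} (hX : ∀ x, |X x| ≤ 2)
    (n : ℕ) {φ : ℝ} (hφ : 0 < φ) :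
    (iid p n).toOuterMeasure {y | n * φ < ∑ i, (X (y i) - expectation p X)} ≤
      ENNReal.ofReal (Real.exp (-(n * φ ^ 2 / 8))) := by
  -- This minimizes the exponent `2 t² - t φ` per draw; the minimum is `-φ² / 8`.
  set t := φ / 4 with ht
  calc (iid p n).toOuterMeasure {y | n * φ < ∑ i, (X (y i) - expectation p X)}
      ≤ ∑' y, iid p n y * (ENNReal.ofReal (Real.exp (-(t * (n * φ)))) *
          ∏ i, ENNReal.ofReal (Real.exp (t * (X (y i) - expectation p X)))) := by
        refine toOuterMeasure_le_tsum_mul _ fun y hy => ?_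
        rw [← ENNReal.ofReal_prod_of_nonneg fun _ _ => (Real.exp_pos _).le, ← Real.exp_sum,
          ← ENNReal.ofReal_mul (Real.exp_pos _).le, ← Real.exp_add, ← Finset.mul_sum,
          ENNReal.one_le_ofReal, Real.one_le_exp_iff]
        have : t * (n * φ) ≤ t * ∑ i, (X (y i) - expectation p X) :=
          mul_le_mul_of_nonneg_left (le_of_lt hy) (by positivity)
        linarith
    _ = ENNReal.ofReal (Real.exp (-(t * (n * φ)))) *
          (∑' x, p x * ENNReal.ofReal (Real.exp (t * (X x - expectation p X)))) ^ n := by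
        simp only [mul_left_comm _ (ENNReal.ofReal (Real.exp (-(t * (n * φ)))))]
        rw [ENNReal.tsum_mul_left]
        congr 1
        exact tsum_iid_mul_prod p
          (fun x => ENNReal.ofReal (Real.exp (t * (X x - expectation p X)))) n
    _ ≤ ENNReal.ofReal (Real.exp (-(t * (n * φ)))) *
          ENNReal.ofReal (Real.exp (2 ^ 2 * t ^ 2 / 2)) ^ n := by
        gcongr
        exact tsum_mul_exp_le p zero_le_two hX t
    _ = ENNReal.ofReal (Real.exp (-(n * φ ^ 2 / 8))) := by
        rw [← ENNReal.ofReal_pow (Real.exp_pos _).le, ← ENNReal.ofReal_mul (Real.exp_pos _).le,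
          ← Real.exp_nat_mul, ← Real.exp_add]
        congr 2
        rw [ht]
        ring

end DREEM

/-! ### Misfit, disagreement, values and test functions -/

namespace DREEM

open scoped ENNReal

theorem enorm_toReal_apply {α : Type*} (p : PMF α) (x : α) : ‖(p x).toReal‖ₑ = p x := by
  rw [Real.enorm_of_nonneg ENNReal.toReal_nonneg, ENNReal.ofReal_toReal (p.apply_ne_top x)]

/-- The extended `ℓ¹` distance between the measures `x • p` and `y • q`. -/
noncomputable def weightedDist {α : Type*} (p q : PMF α) (x y : ℝ) : ℝ≥0∞ :=
  ∑' a, ‖(p a).toReal * x - (q a).toReal * y‖ₑ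

/-- The extended `ℓ¹` distance between two discrete distributions. -/
noncomputable def l1Dist {α : Type*} (p q : PMF α) : ℝ≥0∞ :=
  ∑' a, ‖(p a).toReal - (q a).toReal‖ₑ

theorem tvDist_eq_toReal {α : Type*} (p q : PMF α) : tvDist p q = (l1Dist p q).toReal := by
  rw [l1Dist, ENNReal.tsum_toReal_eq fun _ => enorm_ne_top]
  simp [tvDist, toReal_enorm]

theorem l1Dist_le_two {α : Type*} (p q : PMF α) : l1Dist p q ≤ 2 := by
  calc l1Dist p q ≤ ∑' a, (p a + q a) := by
        refine ENNReal.tsum_le_tsum fun a => ?_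
        exact enorm_sub_le.trans (by rw [enorm_toReal_apply, enorm_toReal_apply])
    _ = 2 := by rw [ENNReal.tsum_add, p.tsum_coe, q.tsum_coe, one_add_one_eq_two]

theorem l1Dist_ne_top {α : Type*} (p q : PMF α) : l1Dist p q ≠ ∞ :=
  ((l1Dist_le_two p q).trans_lt (by simp)).ne

/-- From `p x - q y = p (x - y) + y (p - q)`: the error in the state law separates from the error in
the transition. -/
theorem weightedDist_le {α : Type*} (p q : PMF α) (x y : ℝ) :
    weightedDist p q x y ≤ ‖x - y‖ₑ + ‖y‖ₑ * l1Dist p q := by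
  calc weightedDist p q x y ≤ ∑' a, (p a * ‖x - y‖ₑ + ‖y‖ₑ * ‖(p a).toReal - (q a).toReal‖ₑ) := by
        refine ENNReal.tsum_le_tsum fun a => ?_
        have h : (p a).toReal * x - (q a).toReal * y
            = (p a).toReal * (x - y) + y * ((p a).toReal - (q a).toReal) := by ring
        rw [h, ← enorm_mul]
        exact (enorm_add_le _ _).trans (by rw [enorm_mul, enorm_toReal_apply])
    _ = _ := by
        rw [ENNReal.tsum_add, ENNReal.tsum_mul_right, ENNReal.tsum_mul_left, p.tsum_coe, one_mul,
          l1Dist]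

theorem weightedDist_ne_top {α : Type*} (p q : PMF α) (x y : ℝ) : weightedDist p q x y ≠ ∞ :=
  ne_top_of_le_ne_top (ENNReal.add_ne_top.2
    ⟨enorm_ne_top, ENNReal.mul_ne_top enorm_ne_top (l1Dist_ne_top p q)⟩) (weightedDist_le p q x y)

theorem weightedDist_triangle {α : Type*} (p q r : PMF α) (x y z : ℝ) :
    weightedDist p q x y ≤ weightedDist p r x z + weightedDist q r y z := by
  rw [weightedDist, weightedDist, weightedDist, ← ENNReal.tsum_add]
  refine ENNReal.tsum_le_tsum fun a => ?_
  have h : (p a).toReal * x - (q a).toReal * y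
      = ((p a).toReal * x - (r a).toReal * z) - ((q a).toReal * y - (r a).toReal * z) := by ring
  rw [h]
  exact enorm_sub_le

universe u v

/-- The contribution of one sample to the empirical misfit of `M` with test function `f`. -/
noncomputable def sampleGap {S : Type u} {A : Type v} (M : Model S A) (f : S × A × S → ℝ)
    (x : S × A × S) : ℝ :=
  (∑' s', (M x.1 x.2.1 s').toReal * f (x.1, x.2.1, s')) - f x

theorem abs_sampleGap_le {S : Type u} {A : Type v} (M : Model S A) {f : S × A × S → ℝ}
    (hf : ∀ x, |f x| ≤ 1) (x : S × A × S) : |sampleGap M f x| ≤ 2 := by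
  have h1 : |expectation (M x.1 x.2.1) fun s' => f (x.1, x.2.1, s')| ≤ 1 :=
    abs_expectation_le _ fun _ => hf _
  calc |sampleGap M f x| ≤ _ := abs_sub _ _
    _ ≤ 1 + 1 := add_le_add h1 (hf x)
    _ = 2 := one_add_one_eq_two

/-- The transition weights of two models at time `h`, compared in `ℓ¹` at a state-action pair. -/
noncomputable def jointDist {S : Type u} {A : Type v} (E : Env S A) (π : Policy S A)
    (M M' : Model S A) (h : ℕ) (s : S) (a : A) : ℝ≥0∞ :=
  weightedDist (M s a) (M' s a) (stateDist E M π h s).toReal (stateDist E M' π h s).toReal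

theorem jointDist_le {S : Type u} {A : Type v} (E : Env S A) (π : Policy S A)
    (M M' : Model S A) (h : ℕ) (s : S) (a : A) :
    jointDist E π M M' h s a ≤
      ‖(stateDist E M π h s).toReal - (stateDist E M' π h s).toReal‖ₑ +
        stateDist E M' π h s * l1Dist (M s a) (M' s a) := by
  exact (weightedDist_le _ _ _ _).trans (by rw [enorm_toReal_apply])

variable {S : Type u} {A : Type v} [Fintype A]

/-- The misfit as an extended nonnegative real. -/
noncomputable def eMisfit (E : Env S A) (π : Policy S A) (M : Model S A) (h : ℕ) : ℝ≥0∞ :=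
  ∑' s, stateDist E E.Mstar π h s *
    ∑ a, (Fintype.card A : ℝ≥0∞)⁻¹ * l1Dist (M s a) (E.Mstar s a)

/-- The disagreement as an extended nonnegative real. -/
noncomputable def eDisagreement (E : Env S A) (π : Policy S A) (M M' : Model S A) (h : ℕ) : ℝ≥0∞ :=
  (Fintype.card A : ℝ≥0∞)⁻¹ * ∑' s, ∑ a, jointDist E π M M' h s a

theorem inv_card_mul_card [Nonempty A] : (Fintype.card A : ℝ≥0∞)⁻¹ * Fintype.card A = 1 :=
  ENNReal.inv_mul_cancel (by simp) (by simp)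

theorem eMisfit_le_two [Nonempty A] (E : Env S A) (π : Policy S A) (M : Model S A) (h : ℕ) :
    eMisfit E π M h ≤ 2 := by
  calc eMisfit E π M h ≤ ∑' s, stateDist E E.Mstar π h s * 2 := by
        refine ENNReal.tsum_le_tsum fun s => mul_le_mul_right ?_ _
        calc ∑ a, (Fintype.card A : ℝ≥0∞)⁻¹ * l1Dist (M s a) (E.Mstar s a)
            ≤ ∑ _a : A, (Fintype.card A : ℝ≥0∞)⁻¹ * 2 := by
              gcongr
              exact l1Dist_le_two _ _
          _ = 2 := by
              rw [Finset.sum_const, Finset.card_univ, nsmul_eq_mul, ← mul_assoc, mul_comm _ _⁻¹,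
                inv_card_mul_card, one_mul]
    _ = 2 := by rw [ENNReal.tsum_mul_right, PMF.tsum_coe, one_mul]

theorem eMisfit_ne_top [Nonempty A] (E : Env S A) (π : Policy S A) (M : Model S A) (h : ℕ) :
    eMisfit E π M h ≠ ∞ :=
  ((eMisfit_le_two E π M h).trans_lt (by simp)).ne

theorem misfit_eq_toReal [Nonempty A] (E : Env S A) (π : Policy S A) (M : Model S A) (h : ℕ) :
    misfit E π M h = (eMisfit E π M h).toReal := by
  have hin : ∀ s a, (Fintype.card A : ℝ≥0∞)⁻¹ * l1Dist (M s a) (E.Mstar s a) ≠ ∞ := fun s a =>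
    ENNReal.mul_ne_top (by simp) (l1Dist_ne_top _ _)
  rw [eMisfit, ENNReal.tsum_toReal_eq]
  · refine tsum_congr fun s => ?_
    rw [ENNReal.toReal_mul, ENNReal.toReal_sum fun a _ => hin s a]
    simp [tvDist_eq_toReal]
  · exact fun s => ENNReal.mul_ne_top (PMF.apply_ne_top _ _)
      (ENNReal.sum_ne_top.2 fun a _ => hin s a)

theorem misfit_nonneg [Nonempty A] (E : Env S A) (π : Policy S A) (M : Model S A) (h : ℕ) :
    0 ≤ misfit E π M h := by
  rw [misfit_eq_toReal]
  exact ENNReal.toReal_nonneg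

theorem disagreement_eq_toReal [Nonempty A] (E : Env S A) (π : Policy S A) (M M' : Model S A)
    (h : ℕ) :
    disagreement E π M M' h = (eDisagreement E π M M' h).toReal := by
  have hin : ∀ s a, jointDist E π M M' h s a ≠ ∞ := fun s a => weightedDist_ne_top _ _ _ _
  rw [eDisagreement, ENNReal.toReal_mul, ENNReal.tsum_toReal_eq, disagreement, ← tsum_mul_left]
  · refine tsum_congr fun s => ?_
    rw [ENNReal.toReal_sum fun a _ => hin s a, Finset.mul_sum]
    refine Finset.sum_congr rfl fun a _ => ?_
    rw [jointDist, weightedDist, ENNReal.tsum_toReal_eq fun _ => enorm_ne_top, ← tsum_mul_left]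
    refine tsum_congr fun s' => ?_
    rw [← sub_mul, abs_mul, toReal_enorm, Real.norm_eq_abs, mul_comm,
      abs_of_nonneg (by positivity : (0 : ℝ) ≤ (Fintype.card A : ℝ)⁻¹)]
    simp
  · exact fun s => ENNReal.sum_ne_top.2 fun a _ => hin s a

theorem eDisagreement_triangle (E : Env S A) (π : Policy S A) (M M' M'' : Model S A) (h : ℕ) :
    eDisagreement E π M M' h ≤ eDisagreement E π M M'' h + eDisagreement E π M' M'' h := by
  rw [eDisagreement, eDisagreement, eDisagreement, ← mul_add, ← ENNReal.tsum_add]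
  refine mul_le_mul_right (ENNReal.tsum_le_tsum fun s => ?_) _
  rw [← Finset.sum_add_distrib]
  exact Finset.sum_le_sum fun a _ => weightedDist_triangle _ _ _ _ _ _

theorem eDisagreement_le [Nonempty A] (E : Env S A) (π : Policy S A) (M : Model S A) (h : ℕ) :
    eDisagreement E π M E.Mstar h ≤
      l1Dist (stateDist E M π h) (stateDist E E.Mstar π h) + eMisfit E π M h := by
  rw [eDisagreement, l1Dist, eMisfit, ← ENNReal.tsum_mul_left, ← ENNReal.tsum_add]
  refine ENNReal.tsum_le_tsum fun s => ?_
  rw [Finset.mul_sum, Finset.mul_sum]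
  calc _ ≤ ∑ a : A, ((Fintype.card A : ℝ≥0∞)⁻¹ *
        ‖(stateDist E M π h s).toReal - (stateDist E E.Mstar π h s).toReal‖ₑ +
        stateDist E E.Mstar π h s *
          ((Fintype.card A : ℝ≥0∞)⁻¹ * l1Dist (M s a) (E.Mstar s a))) := by
        refine Finset.sum_le_sum fun a _ => ?_
        rw [mul_left_comm (stateDist E E.Mstar π h s), ← mul_add]
        exact mul_le_mul_right (jointDist_le E π M E.Mstar h s a) _
    _ = _ := by
        rw [Finset.sum_add_distrib, Finset.sum_const, Finset.card_univ, nsmul_eq_mul, ← mul_assoc,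
          mul_comm _ _⁻¹, inv_card_mul_card, one_mul]

theorem toReal_stateDist_succ (E : Env S A) (M : Model S A) (π : Policy S A) (h : ℕ) (s' : S) :
    (stateDist E M π (h + 1) s').toReal =
      ∑' s, (stateDist E M π h s).toReal * ∑ a, (π h s a).toReal * (M s a s').toReal := by
  rw [stateDist, toReal_bind_apply]
  refine tsum_congr fun s => ?_
  rw [toReal_bind_apply, tsum_fintype]

/-- Passing from the joint law of state, action and next state to the law of the next state does not
increase the `ℓ¹` distance. -/
theorem l1Dist_stateDist_succ_le (E : Env S A) (π : Policy S A) (M M' : Model S A) (h : ℕ) :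
    l1Dist (stateDist E M π (h + 1)) (stateDist E M' π (h + 1)) ≤
      ∑' s, ∑ a, π h s a * jointDist E π M M' h s a := by
  have hsum : ∀ (N : Model S A) (s' : S), Summable fun s =>
      (stateDist E N π h s).toReal * ∑ a, (π h s a).toReal * (N s a s').toReal := by
    intro N s'
    refine summable_toReal_mul _ (C := ∑ _a : A, 1) fun s => ?_
    refine (Finset.abs_sum_le_sum_abs _ _).trans (Finset.sum_le_sum fun a _ => ?_)
    rw [abs_of_nonneg (by positivity)]
    exact mul_le_one₀
      (ENNReal.toReal_le_of_le_ofReal zero_le_one (by simpa using PMF.coe_le_one _ _))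
      ENNReal.toReal_nonneg
      (ENNReal.toReal_le_of_le_ofReal zero_le_one (by simpa using PMF.coe_le_one _ _))
  calc l1Dist (stateDist E M π (h + 1)) (stateDist E M' π (h + 1))
      ≤ ∑' s', ∑' s, ∑ a, π h s a * ‖(M s a s').toReal * (stateDist E M π h s).toReal -
          (M' s a s').toReal * (stateDist E M' π h s).toReal‖ₑ := by
        refine ENNReal.tsum_le_tsum fun s' => ?_
        rw [toReal_stateDist_succ, toReal_stateDist_succ, ← (hsum M s').tsum_sub (hsum M' s')]
        refine enorm_tsum_le_tsum_enorm.trans (ENNReal.tsum_le_tsum fun s => ?_)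
        rw [Finset.mul_sum, Finset.mul_sum, ← Finset.sum_sub_distrib]
        refine (enorm_sum_le _ _).trans (Finset.sum_le_sum fun a _ => ?_)
        refine le_of_eq ?_
        calc _ = ‖(π h s a).toReal * ((M s a s').toReal * (stateDist E M π h s).toReal -
              (M' s a s').toReal * (stateDist E M' π h s).toReal)‖ₑ := by congr 1; ring
          _ = _ := by rw [enorm_mul, enorm_toReal_apply]
    _ = _ := by
        rw [ENNReal.tsum_comm]
        refine tsum_congr fun s => ?_
        rw [Summable.tsum_finsetSum fun _ _ => ENNReal.summable]
        refine Finset.sum_congr rfl fun a _ => ?_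
        rw [ENNReal.tsum_mul_left, jointDist, weightedDist]

/-- The factor `|𝒜|` is the price of replacing the action of `π` by a uniform one: `π h s a ≤ 1 =
|𝒜| · |𝒜|⁻¹`. -/
theorem l1Dist_stateDist_succ_le_eDisagreement [Nonempty A] (E : Env S A) (π : Policy S A)
    (M M' : Model S A)
    (h : ℕ) : l1Dist (stateDist E M π (h + 1)) (stateDist E M' π (h + 1)) ≤
      Fintype.card A * eDisagreement E π M M' h := by
  refine (l1Dist_stateDist_succ_le E π M M' h).trans ?_
  rw [eDisagreement, ← mul_assoc, mul_comm _ _⁻¹, inv_card_mul_card, one_mul]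
  refine ENNReal.tsum_le_tsum fun s => Finset.sum_le_sum fun a _ => ?_
  exact mul_le_of_le_one_left (by simp) (PMF.coe_le_one _ _)

theorem l1Dist_stateDist_succ_le_add_eMisfit [Nonempty A] (E : Env S A) (π : Policy S A)
    (M : Model S A)
    (h : ℕ) : l1Dist (stateDist E M π (h + 1)) (stateDist E E.Mstar π (h + 1)) ≤
      l1Dist (stateDist E M π h) (stateDist E E.Mstar π h) +
        Fintype.card A * eMisfit E π M h := by
  refine (l1Dist_stateDist_succ_le E π M E.Mstar h).trans ?_
  rw [l1Dist, eMisfit, ← ENNReal.tsum_mul_left, ← ENNReal.tsum_add]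
  refine ENNReal.tsum_le_tsum fun s => ?_
  have hπ : ∑ a, π h s a = 1 := (tsum_fintype _).symm.trans (π h s).tsum_coe
  rw [mul_left_comm, Finset.mul_sum, Finset.mul_sum]
  -- Only the transition error has its policy weight replaced by 1. The inherited error keeps
  -- weights that sum to 1, so errors add over time instead of being multiplied by `|𝒜|` at each
  -- step.
  calc _ ≤ ∑ a, (π h s a * ‖(stateDist E M π h s).toReal - (stateDist E E.Mstar π h s).toReal‖ₑ +
          stateDist E E.Mstar π h s * l1Dist (M s a) (E.Mstar s a)) := by
        refine Finset.sum_le_sum fun a _ => ?_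
        refine (mul_le_mul_right (jointDist_le E π M E.Mstar h s a) _).trans ?_
        rw [mul_add]
        exact add_le_add_right (mul_le_of_le_one_left (by simp) (PMF.coe_le_one _ _)) _
    _ = _ := by
        rw [Finset.sum_add_distrib, ← Finset.sum_mul, hπ, one_mul]
        congr 1
        refine Finset.sum_congr rfl fun a _ => ?_
        rw [← mul_assoc (Fintype.card A : ℝ≥0∞), mul_comm (Fintype.card A : ℝ≥0∞) _⁻¹,
          inv_card_mul_card, one_mul]

theorem l1Dist_stateDist_le [Nonempty A] (E : Env S A) (π : Policy S A) (M : Model S A) (h : ℕ) :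
    l1Dist (stateDist E M π h) (stateDist E E.Mstar π h) ≤
      Fintype.card A * ∑ k ∈ Finset.range h, eMisfit E π M k := by
  induction h with
  | zero => simp [stateDist, l1Dist]
  | succ h ih =>
    rw [Finset.sum_range_succ, mul_add]
    exact (l1Dist_stateDist_succ_le_add_eMisfit E π M h).trans (by gcongr)

theorem eDisagreement_ne_top [Nonempty A] (E : Env S A) (π : Policy S A) (M M' : Model S A)
    (h : ℕ) :
    eDisagreement E π M M' h ≠ ∞ := by
  have hstar : ∀ N, eDisagreement E π N E.Mstar h ≠ ∞ := fun N =>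
    ne_top_of_le_ne_top (ENNReal.add_ne_top.2 ⟨l1Dist_ne_top _ _, eMisfit_ne_top E π N h⟩)
      (eDisagreement_le E π N h)
  exact ne_top_of_le_ne_top (ENNReal.add_ne_top.2 ⟨hstar M, hstar M'⟩)
    (eDisagreement_triangle E π M M' E.Mstar h)

theorem disagreement_triangle [Nonempty A] (E : Env S A) (π : Policy S A) (M M' M'' : Model S A)
    (h : ℕ) :
    disagreement E π M M' h ≤ disagreement E π M M'' h + disagreement E π M' M'' h := by
  simp only [disagreement_eq_toReal]
  rw [← ENNReal.toReal_add (eDisagreement_ne_top _ _ _ _ _) (eDisagreement_ne_top _ _ _ _ _)]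
  exact ENNReal.toReal_mono (ENNReal.add_ne_top.2
    ⟨eDisagreement_ne_top _ _ _ _ _, eDisagreement_ne_top _ _ _ _ _⟩)
    (eDisagreement_triangle E π M M' M'' h)

theorem disagreement_le_misfit [Nonempty A] (E : Env S A) (π : Policy S A) (M : Model S A) (h : ℕ) :
    disagreement E π M E.Mstar h ≤
      Fintype.card A * ∑ k ∈ Finset.range h, misfit E π M k + misfit E π M h := by
  have h1 := (eDisagreement_le E π M h).trans (add_le_add_left (l1Dist_stateDist_le E π M h) _)
  have h2 : ∑ k ∈ Finset.range h, eMisfit E π M k ≠ ∞ :=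
    ENNReal.sum_ne_top.2 fun k _ => eMisfit_ne_top E π M k
  have h3 : (Fintype.card A : ℝ≥0∞) * ∑ k ∈ Finset.range h, eMisfit E π M k ≠ ∞ :=
    ENNReal.mul_ne_top (by simp) h2
  have h4 := ENNReal.toReal_mono (ENNReal.add_ne_top.2 ⟨h3, eMisfit_ne_top E π M h⟩) h1
  rw [ENNReal.toReal_add h3 (eMisfit_ne_top E π M h), ENNReal.toReal_mul,
    ENNReal.toReal_sum fun k _ => eMisfit_ne_top E π M k] at h4
  simpa only [disagreement_eq_toReal, misfit_eq_toReal, ENNReal.toReal_natCast] using h4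

/-- If all misfits of `M` are at most `w`, then its total disagreement with the truth is at most
`|𝒜| H² w`. -/
theorem sum_disagreement_le [Nonempty A] (E : Env S A) (H : ℕ) (π : Policy S A) (M : Model S A)
    {w : ℝ}
    (hw : ∀ h < H, misfit E π M h ≤ w) :
    ∑ h ∈ Finset.range H, disagreement E π M E.Mstar h ≤ Fintype.card A * (H : ℝ) ^ 2 * w := by
  have hA : (1 : ℝ) ≤ Fintype.card A := by exact_mod_cast Fintype.card_pos
  calc ∑ h ∈ Finset.range H, disagreement E π M E.Mstar h
      ≤ ∑ _h ∈ Finset.range H, Fintype.card A * (H : ℝ) * w := by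
        refine Finset.sum_le_sum fun h hh => ?_
        rw [Finset.mem_range] at hh
        have h0 : 0 ≤ w := (misfit_nonneg E π M h).trans (hw h hh)
        have h1 : ∑ k ∈ Finset.range h, misfit E π M k ≤ h * w := by
          calc _ ≤ ∑ _k ∈ Finset.range h, w := Finset.sum_le_sum fun k hk =>
                hw k ((Finset.mem_range.1 hk).trans hh)
            _ = h * w := by simp
        have h2 : (h : ℝ) + 1 ≤ H := by exact_mod_cast hh
        calc disagreement E π M E.Mstar h
            ≤ Fintype.card A * (h * w) + w := by
              refine (disagreement_le_misfit E π M h).trans ?_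
              gcongr
              exact hw h hh
          _ ≤ Fintype.card A * (h * w) + Fintype.card A * w := by
              gcongr
              exact le_mul_of_one_le_left h0 hA
          _ = Fintype.card A * (h + 1) * w := by ring
          _ ≤ _ := by gcongr
    _ = _ := by rw [Finset.sum_const, Finset.card_range, nsmul_eq_mul]; ring

/-- A large exploration objective reveals a model in the current set with a large misfit. -/
theorem exists_lt_misfit [Nonempty A] (E : Env S A) {H : ℕ} (hH : 0 < H) (π : Policy S A)
    {N : Finset (Model S A)} (hN : N.Nonempty) {ε : ℝ}
    (hε : ε / Fintype.card A < vExplore E H π N) :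
    ∃ M ∈ N, ∃ h : Fin H,
      ε / (2 * (H : ℝ) ^ 2 * (Fintype.card A : ℝ) ^ 2) < misfit E π M h := by
  have : Nonempty N := hN.to_subtype
  have hA : (0 : ℝ) < Fintype.card A := by exact_mod_cast Fintype.card_pos
  have hH' : (0 : ℝ) < H := by exact_mod_cast hH
  obtain ⟨⟨M, M'⟩, hlt⟩ := exists_lt_of_lt_ciSup hε
  by_contra! hcon
  have key : ∀ K ∈ N, ∑ h ∈ Finset.range H, disagreement E π K E.Mstar h ≤
      Fintype.card A * (H : ℝ) ^ 2 * (ε / (2 * (H : ℝ) ^ 2 * (Fintype.card A : ℝ) ^ 2)) :=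
    fun K hK => sum_disagreement_le E H π K fun h hh => hcon K hK ⟨h, hh⟩
  have h1 := key M M.2
  have h2 := key M' M'.2
  have h3 : ∑ h ∈ Finset.range H, disagreement E π M.1 M'.1 h ≤
      ∑ h ∈ Finset.range H, disagreement E π M E.Mstar h +
        ∑ h ∈ Finset.range H, disagreement E π M' E.Mstar h := by
    rw [← Finset.sum_add_distrib]
    exact Finset.sum_le_sum fun h _ => disagreement_triangle E π M M' E.Mstar h
  have h4 : Fintype.card A * (H : ℝ) ^ 2 * (ε / (2 * (H : ℝ) ^ 2 * (Fintype.card A : ℝ) ^ 2))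
      = ε / Fintype.card A / 2 := by
    field_simp
  rw [h4] at h1 h2
  simp only at hlt
  linarith

theorem sum_disagreement_le_vExplore (E : Env S A) (H : ℕ) (π : Policy S A)
    {N : Finset (Model S A)} {M M' : Model S A} (hM : M ∈ N) (hM' : M' ∈ N) :
    ∑ h ∈ Finset.range H, disagreement E π M M' h ≤ vExplore E H π N :=
  le_ciSup (f := fun p : N × N => ∑ h ∈ Finset.range H, disagreement E π p.1.1 p.2.1 h)
    (Set.finite_range _).bddAbove (⟨M, hM⟩, ⟨M', hM'⟩)

/-- Both laws have mass 1, so the reward may be centred at `1 / 2`. The factor `1 / 2` gained here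
is what makes the final loss `ε` rather than `2 ε`. -/
theorem abs_tsum_mul_sub_le (p q : PMF S) {R : S → ℝ} (h0 : ∀ s, 0 ≤ R s) (h1 : ∀ s, R s ≤ 1) :
    |∑' s, (p s).toReal * R s - ∑' s, (q s).toReal * R s| ≤ (l1Dist p q).toReal / 2 := by
  have hR : ∀ s, |R s - 1 / 2| ≤ 1 / 2 := fun s => by
    rw [abs_le]; constructor <;> linarith [h0 s, h1 s]
  have hcent : ∀ r : PMF S, ∑' s, (r s).toReal * R s
      = ∑' s, (r s).toReal * (R s - 1 / 2) + 1 / 2 := by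
    intro r
    have hr := (summable_toReal_mul r hR).hasSum.add ((hasSum_toReal r).mul_right (1 / 2))
    rw [one_mul] at hr
    rw [← hr.tsum_eq]
    exact tsum_congr fun s => by ring
  have hs : Summable fun s => |(p s).toReal - (q s).toReal| :=
    ((hasSum_toReal p).summable.sub (hasSum_toReal q).summable).abs
  rw [hcent p, hcent q, add_sub_add_right_eq_sub,
    ← (summable_toReal_mul p hR).tsum_sub (summable_toReal_mul q hR), ← tvDist_eq_toReal,
    tvDist, ← Real.norm_eq_abs, div_eq_mul_inv]
  refine tsum_of_norm_bounded (hs.hasSum.mul_right _) fun s => ?_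
  rw [← sub_mul, norm_mul, Real.norm_eq_abs, Real.norm_eq_abs]
  gcongr
  simpa using hR s

theorem abs_value_sub_le [Nonempty A] (E : Env S A) (H : ℕ) (M M' : Model S A) (π : Policy S A) :
    |value E H M π - value E H M' π| ≤
      Fintype.card A * (∑ h ∈ Finset.range H, disagreement E π M M' h) / 2 := by
  rw [value, value, ← Finset.sum_sub_distrib, Finset.mul_sum, Finset.sum_div]
  refine (Finset.abs_sum_le_sum_abs _ _).trans (Finset.sum_le_sum fun h _ => ?_)
  refine (abs_tsum_mul_sub_le _ _ E.R_nonneg E.R_le_one).trans ?_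
  have := ENNReal.toReal_mono
    (ENNReal.mul_ne_top (by simp) (eDisagreement_ne_top E π M M' h))
    (l1Dist_stateDist_succ_le_eDisagreement E π M M' h)
  rw [ENNReal.toReal_mul, ← disagreement_eq_toReal, ENNReal.toReal_natCast] at this
  gcongr

theorem testGap_neg (E : Env S A) (π : Policy S A) (M : Model S A) (h : ℕ) (f : S × A × S → ℝ) :
    testGap E π M h (-f) = -testGap E π M h f := by
  simp only [testGap, Pi.neg_apply, mul_neg, ← tsum_neg]
  refine tsum_congr fun s => ?_
  rw [← mul_neg, ← Finset.sum_neg_distrib]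
  congr 1
  refine Finset.sum_congr rfl fun a _ => ?_
  rw [tsum_neg, tsum_neg]
  ring

theorem testGap_Mstar (E : Env S A) (π : Policy S A) (h : ℕ) (f : S × A × S → ℝ) :
    testGap E π E.Mstar h f = 0 := by
  simp [testGap]

/-- The sign of the difference of transition probabilities attains the `ℓ¹` distance at all
state-action pairs at once. -/
theorem exists_testGap_eq_misfit (E : Env S A) (π : Policy S A) (M : Model S A) (h : ℕ) :
    ∃ f : S × A × S → ℝ, (∀ x, |f x| ≤ 1) ∧ testGap E π M h f = misfit E π M h := by
  have hf : ∀ x : ℝ, |(SignType.sign x : ℝ)| ≤ 1 := fun x => by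
    rcases lt_trichotomy x 0 with hx | hx | hx <;> simp [hx]
  refine ⟨fun x => SignType.sign ((M x.1 x.2.1 x.2.2).toReal - (E.Mstar x.1 x.2.1 x.2.2).toReal),
    fun x => hf _, ?_⟩
  refine tsum_congr fun s => ?_
  congr 1
  refine Finset.sum_congr rfl fun a _ => ?_
  congr 1
  rw [← (summable_toReal_mul (M s a) fun _ => hf _).tsum_sub
    (summable_toReal_mul (E.Mstar s a) fun _ => hf _)]
  refine tsum_congr fun s' => ?_
  rw [← sub_mul, mul_comm, sign_mul_self]

theorem misfit_le_testGap {E : Env S A} {H : ℕ} {Pi : Finset (Policy S A)}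
    {Ms : Finset (Model S A)} {F : Policy S A → Model S A → Fin H → S × A × S → ℝ}
    (hF : IsTestFamily E H Pi Ms F) {π : Policy S A} (hπ : π ∈ Pi) {M : Model S A} (hM : M ∈ Ms)
    (h : Fin H) : misfit E π M h ≤ testGap E π M h (F π M h) := by
  obtain ⟨f, hf, he⟩ := exists_testGap_eq_misfit E π M h
  rw [← he]
  exact (hF π hπ M hM h).2 f hf

/-- Each sample is an unbiased estimate of the gap, so Hoeffding's inequality applies to the
empirical misfit. -/
theorem expectation_sampleLaw [Nonempty A] (E : Env S A) (π : Policy S A) (M : Model S A) (h : ℕ)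
    {f : S × A × S → ℝ} (hf : ∀ x, |f x| ≤ 1) :
    expectation (sampleLaw E π h) (sampleGap M f) = testGap E π M h f := by
  rw [sampleLaw, expectation_bind _ _ (abs_sampleGap_le M hf), testGap, expectation]
  refine tsum_congr fun s => ?_
  rw [expectation_bind _ _ (abs_sampleGap_le M hf), expectation_uniformOfFintype]
  congr 1
  refine Finset.sum_congr rfl fun a _ => ?_
  congr 1
  rw [expectation_map _ _ (abs_sampleGap_le M hf), expectation]
  simp only [sampleGap, mul_sub]
  set m := ∑' s', (M s a s').toReal * f (s, a, s')
  have h1 := (hasSum_toReal (E.Mstar s a)).mul_right m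
  rw [one_mul] at h1
  rw [h1.summable.tsum_sub (summable_toReal_mul _ fun _ => hf _), h1.tsum_eq]

/-- Hoeffding's inequality for the empirical misfit with one test function. -/
theorem toOuterMeasure_sampleGap_le [Nonempty A] {E : Env S A} {H : ℕ}
    {τ : Policy S A → PMF (Trajectory S A H)} (hτ : IsTrajectoryLaw E H τ) (π : Policy S A)
    (M : Model S A) (h : Fin H) {f : S × A × S → ℝ} (hf : ∀ x, |f x| ≤ 1) (n : ℕ) {φ : ℝ}
    (hφ : 0 < φ) :
    (iid (τ π) n).toOuterMeasure
        {D | n * φ < ∑ i, (sampleGap M f (D i h) - testGap E π M h f)} ≤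
      ENNReal.ofReal (Real.exp (-(n * φ ^ 2 / 8))) := by
  have hE : expectation (τ π) (fun x => sampleGap M f (x h)) = testGap E π M h f := by
    rw [← expectation_map _ (fun x : Trajectory S A H => x h) (abs_sampleGap_le M hf), hτ π h,
      expectation_sampleLaw E π M h hf]
  rw [← hE]
  exact toOuterMeasure_iid_le_exp (τ π) (X := fun x => sampleGap M f (x h))
    (fun x => abs_sampleGap_le M hf _) n hφ

end DREEM

/-! ### Bounded histories, accurate data and the failure probability -/

namespace DREEM

open scoped ENNReal

universe u v

theorem exists_hasFactorization {m n : Type*} {B : Matrix m n ℝ} {β : ℝ} {d : ℕ}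
    (h : normRank B β ≤ d) : ∃ k ≤ d, HasFactorization B β k := by
  by_contra! hcon
  have h1 : ((d + 1 : ℕ) : ℕ∞) ≤ normRank B β := by
    refine le_iInf₂ fun k hk => ?_
    have : d < k := by
      by_contra! hkd
      exact hcon k hkd hk
    exact_mod_cast this
  have h2 : ((d + 1 : ℕ) : ℕ∞) ≤ (d : ℕ∞) := h1.trans h
  exact absurd (Nat.cast_le.1 h2) (by omega)

theorem HasFactorization.le {m n : Type*} {B : Matrix m n ℝ} {β : ℝ} {k : ℕ}
    (h : HasFactorization B β k) (i : m) (j : n) : B i j ≤ β := by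
  obtain ⟨U, V, hUV, hb⟩ := h
  rw [hUV]
  exact (real_inner_le_norm _ _).trans (hb i j)

/-- The number of entries found one after the other, each of them large while the entries in
earlier rows and its column are small, in a matrix with a norm-constrained factorization. -/
theorem HasFactorization.length_le {m n : Type*} [Finite m] [Finite n] {B : Matrix m n ℝ} {β : ℝ}
    {k d : ℕ} (hB : HasFactorization B β k) (hkd : k ≤ d) (hd : 0 < d) {η : ℝ} (hη : 0 < η)
    (hβ : 0 ≤ Real.log (β / η)) (l : List (m × n))
    (hpair : l.Pairwise fun x y => |B y.1 x.2| ≤ η)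
    (hwide : ∀ x ∈ l, 6 * η * √d < B x.1 x.2) :
    l.length * Real.log 2 ≤ d * Real.log (β / η) := by
  rcases eq_or_ne l [] with rfl | hl
  · rw [List.length_nil, Nat.cast_zero, zero_mul]
    exact mul_nonneg (Nat.cast_nonneg d) hβ
  obtain ⟨U, V, hUV, hb⟩ := hB
  obtain ⟨x, hx⟩ := List.exists_mem_of_ne_nil l hl
  have : Nonempty m := ⟨x.1⟩
  have : Nonempty n := ⟨x.2⟩
  -- The factorization bounds only products of norms. The separate maxima are attained, at `i` and
  -- `j`, so their product is still at most `β`.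
  obtain ⟨i, hi⟩ := Finite.exists_max fun i => ‖U i‖
  obtain ⟨j, hj⟩ := Finite.exists_max fun j => ‖V j‖
  have hu : ∀ x ∈ l.map fun x => (U x.1, V x.2), ‖x.1‖ ≤ ‖U i‖ := by
    rw [List.forall_mem_map]
    exact fun x _ => hi x.1
  have hv : ∀ x ∈ l.map fun x => (U x.1, V x.2), ‖x.2‖ ≤ ‖V j‖ := by
    rw [List.forall_mem_map]
    exact fun x _ => hj x.2
  have hp : (l.map fun x => (U x.1, V x.2)).Pairwise fun x y => |inner ℝ y.1 x.2| ≤ η := by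
    rw [List.pairwise_map]
    exact hpair.imp fun h => by rwa [hUV] at h
  have hw : ∀ x ∈ l.map fun x => (U x.1, V x.2), 6 * η * √d < inner ℝ x.1 x.2 := by
    rw [List.forall_mem_map]
    exact fun x hx => by rw [← hUV]; exact hwide x hx
  obtain ⟨h1, h2⟩ := length_cuts_le hkd hd hη (norm_nonneg (U i)) (norm_nonneg (V j))
    _ hp hw hu hv (by simpa using hl)
  rw [List.length_map] at h2
  have h3 : Real.log (‖U i‖ * ‖V j‖ / η) ≤ Real.log (β / η) := by
    have : 0 < ‖U i‖ * ‖V j‖ := hη.trans h1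
    have := hb i j
    exact Real.log_le_log (by positivity) (by gcongr)
  calc _ ≤ k * Real.log (‖U i‖ * ‖V j‖ / η) := h2
    _ ≤ k * Real.log (β / η) := by gcongr
    _ ≤ d * Real.log (β / η) := by gcongr

theorem length_eq_sum_length_filter {α ι : Type*} [Fintype ι] [DecidableEq ι] (g : α → ι)
    (l : List α) : l.length = ∑ i, (l.filter fun x => g x = i).length := by
  induction l with
  | nil => simp
  | cons a l ih =>
    have h : ∀ i, ((a :: l).filter fun x => g x = i).length =
        (if g a = i then 1 else 0) + (l.filter fun x => g x = i).length := by
      intro i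
      by_cases hi : g a = i <;> simp [hi, add_comm]
    simp only [h, Finset.sum_add_distrib, ← ih, List.length_cons]
    simp [add_comm]

theorem updateModelSet_subset {S : Type u} {A : Type v} {H n : ℕ} (Ft : Set (S × A × S → ℝ)) (φ : ℝ)
    (N : Finset (Model S A)) (D : Dataset S A H n) : updateModelSet Ft φ N D ⊆ N := by
  classical
  exact Finset.filter_subset _ _

variable {S : Type u} {A : Type v} [Fintype A]

/-- The witnesses of past exploration rounds, most recent first: in each round a policy, a model
and a step with misfit above `w`, where all later models and the models in `N` have misfit at most
`η` under that policy. -/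
structure IsHistory (E : Env S A) {H : ℕ} (Pi : Finset (Policy S A)) (Ms : Finset (Model S A))
    (η w : ℝ) (N : Finset (Model S A)) (l : List (Pi × Ms × Fin H)) : Prop where
  wide : ∀ x ∈ l, w < misfit E x.1 x.2.1 x.2.2
  pairwise : l.Pairwise fun x y => ∀ h : Fin H, misfit E y.1 x.2.1 h ≤ η
  small : ∀ x ∈ l, ∀ M ∈ N, ∀ h : Fin H, misfit E x.1 M h ≤ η

/-- The witnesses are sorted by their step; those of one step form a sequence of deep cuts for one
misfit matrix. -/
theorem IsHistory.length_le [Nonempty A] {E : Env S A} {H : ℕ} {Pi : Finset (Policy S A)}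
    {Ms : Finset (Model S A)} {η : ℝ} {N : Finset (Model S A)} {l : List (Pi × Ms × Fin H)} {β : ℝ}
    {d : ℕ} (hrank : (⨆ h : Fin H, normRank (misfitMatrix E Pi Ms h) β) = (d : ℕ∞)) (hd : 0 < d)
    (hη : 0 < η) (hβ : 0 ≤ Real.log (β / η)) (hl : IsHistory E Pi Ms η (6 * η * √d) N l) :
    l.length * Real.log 2 ≤ H * d * Real.log (β / η) := by
  classical
  rw [length_eq_sum_length_filter (fun x => x.2.2) l]
  push_cast
  rw [Finset.sum_mul]
  calc _ ≤ ∑ _h : Fin H, d * Real.log (β / η) := by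
        refine Finset.sum_le_sum fun h _ => ?_
        obtain ⟨k, hkd, hk⟩ := exists_hasFactorization
          ((le_iSup (fun h : Fin H => normRank (misfitMatrix E Pi Ms h) β) h).trans hrank.le)
        have := hk.length_le hkd hd hη hβ
          ((l.filter fun x => x.2.2 = h).map fun x => (x.1, x.2.1))
          (by
            rw [List.pairwise_map]
            refine (hl.pairwise.filter _).imp fun {x y} hxy => ?_
            rw [misfitMatrix, Matrix.of_apply, abs_of_nonneg (misfit_nonneg _ _ _ _)]
            exact hxy h)
          (by
            simp only [List.forall_mem_map, List.mem_filter, decide_eq_true_eq, misfitMatrix,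
              Matrix.of_apply]
            rintro x ⟨hx, rfl⟩
            exact hl.wide x hx)
        simpa using this
    _ = _ := by simp [mul_assoc]

theorem misfit_le_of_normRank {E : Env S A} {H : ℕ} {Pi : Finset (Policy S A)}
    {Ms : Finset (Model S A)} {β : ℝ} {d : ℕ}
    (hrank : (⨆ h : Fin H, normRank (misfitMatrix E Pi Ms h) β) = (d : ℕ∞)) {π : Policy S A}
    (hπ : π ∈ Pi) {M : Model S A} (hM : M ∈ Ms) (h : Fin H) : misfit E π M h ≤ β := by
  obtain ⟨k, -, hk⟩ := exists_hasFactorization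
    ((le_iSup (fun h : Fin H => normRank (misfitMatrix E Pi Ms h) β) h).trans hrank.le)
  exact hk.le ⟨π, hπ⟩ ⟨M, hM⟩

/-- All empirical averages of test functions are at most `φ` above their expectations. -/
def IsAccurate (E : Env S A) {H n : ℕ} (Ms : Finset (Model S A)) (Ft : Set (S × A × S → ℝ)) (φ : ℝ)
    (π : Policy S A) (D : Dataset S A H n) : Prop :=
  ∀ M ∈ Ms, ∀ h : Fin H, ∀ f ∈ Ft, ∑ i, (sampleGap M f (D i h) - testGap E π M h f) ≤ n * φ

/-- A union bound over model, step and signed test function. It runs over all of `Ms`, not over the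
current model set, so it holds whatever the earlier rounds produced. -/
theorem toOuterMeasure_not_isAccurate_le [Nonempty A] {E : Env S A} {H : ℕ}
    {Pi : Finset (Policy S A)} {Ms : Finset (Model S A)}
    {F : Policy S A → Model S A → Fin H → S × A × S → ℝ} (hF : IsTestFamily E H Pi Ms F)
    {τ : Policy S A → PMF (Trajectory S A H)} (hτ : IsTrajectoryLaw E H τ) (π : Policy S A)
    (n : ℕ) {φ : ℝ} (hφ : 0 < φ) :
    (iid (τ π) n).toOuterMeasure {D | ¬ IsAccurate E Ms (testSet Pi Ms F) φ π D} ≤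
      ENNReal.ofReal (2 * (H : ℝ) ^ 2 * (Ms.card : ℝ) ^ 2 * Pi.card *
        Real.exp (-(n * φ ^ 2 / 8))) := by
  let I := (Ms × Fin H) × ((Pi × Ms × Fin H) × Bool)
  let f : I → S × A × S → ℝ := fun j =>
    bif j.2.2 then F j.2.1.1 j.2.1.2.1 j.2.1.2.2 else -F j.2.1.1 j.2.1.2.1 j.2.1.2.2
  have hf : ∀ j x, |f j x| ≤ 1 := by
    rintro ⟨_, ⟨⟨π', M', h'⟩, b⟩⟩ x
    have := (hF π' π'.2 M' M'.2 h').1 x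
    cases b <;> simpa [f] using this
  calc _ ≤ (iid (τ π) n).toOuterMeasure (⋃ j ∈ (Finset.univ : Finset I),
        {D | n * φ < ∑ i, (sampleGap j.1.1.1 (f j) (D i j.1.2) -
          testGap E π j.1.1.1 j.1.2 (f j))}) := by
        refine MeasureTheory.measure_mono fun D hD => ?_
        simp only [IsAccurate, Set.mem_ofPred_eq, not_forall, not_le] at hD
        obtain ⟨M, hM, h, g, ⟨π', hπ', M', hM', h', hg⟩, hlt⟩ := hD
        simp only [Set.mem_iUnion]
        rcases hg with rfl | rfl
        · exact ⟨((⟨M, hM⟩, h), ((⟨π', hπ'⟩, ⟨M', hM'⟩, h'), true)), Finset.mem_univ _, hlt⟩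
        · exact ⟨((⟨M, hM⟩, h), ((⟨π', hπ'⟩, ⟨M', hM'⟩, h'), false)), Finset.mem_univ _, hlt⟩
    _ ≤ ∑ _j : I, ENNReal.ofReal (Real.exp (-(n * φ ^ 2 / 8))) := by
        refine (MeasureTheory.measure_biUnion_finset_le _ _).trans
          (Finset.sum_le_sum fun j _ => ?_)
        exact toOuterMeasure_sampleGap_le hτ π j.1.1.1 j.1.2 (hf j) n hφ
    _ = _ := by
        rw [Finset.sum_const, nsmul_eq_mul, ENNReal.ofReal_mul (by positivity),
          ← ENNReal.ofReal_natCast]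
        congr 2
        simp only [I, Finset.card_univ, Fintype.card_prod, Fintype.card_coe, Fintype.card_fin,
          Fintype.card_bool]
        push_cast
        ring

theorem sum_sampleGap_le {E : Env S A} {H n : ℕ} {Ms : Finset (Model S A)}
    {Ft : Set (S × A × S → ℝ)} {φ : ℝ} {π : Policy S A} {D : Dataset S A H n}
    (hD : IsAccurate E Ms Ft φ π D) (hn : 0 < n) {M : Model S A} (hM : M ∈ Ms) (h : Fin H)
    {f : S × A × S → ℝ} (hf : f ∈ Ft) :
    (n : ℝ)⁻¹ * ∑ i, sampleGap M f (D i h) ≤ testGap E π M h f + φ := by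
  have hn' : (0 : ℝ) < n := by exact_mod_cast hn
  have h1 := hD M hM h f hf
  rw [Finset.sum_sub_distrib, Finset.sum_const, Finset.card_univ, Fintype.card_fin,
    nsmul_eq_mul] at h1
  rw [inv_mul_le_iff₀ hn']
  linarith

theorem Mstar_mem_updateModelSet {E : Env S A} {H n : ℕ} {Ms N : Finset (Model S A)}
    {Ft : Set (S × A × S → ℝ)} {φ : ℝ} (hφ : 0 ≤ φ) {π : Policy S A} {D : Dataset S A H n}
    (hD : IsAccurate E Ms Ft φ π D) (hn : 0 < n) (hM : E.Mstar ∈ Ms) (hN : E.Mstar ∈ N) :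
    E.Mstar ∈ updateModelSet Ft φ N D := by
  classical
  rw [updateModelSet, Finset.mem_filter]
  refine ⟨hN, fun h => Real.sSup_le ?_ hφ⟩
  rintro _ ⟨f, hf, rfl⟩
  have h1 := sum_sampleGap_le hD hn hM h hf
  rwa [testGap_Mstar, zero_add] at h1

theorem misfit_le_of_mem_updateModelSet {E : Env S A} {H n : ℕ} {Pi : Finset (Policy S A)}
    {Ms N : Finset (Model S A)} {F : Policy S A → Model S A → Fin H → S × A × S → ℝ}
    (hF : IsTestFamily E H Pi Ms F) {φ : ℝ} {π : Policy S A} (hπ : π ∈ Pi) {D : Dataset S A H n}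
    (hD : IsAccurate E Ms (testSet Pi Ms F) φ π D) (hn : 0 < n) (hN : N ⊆ Ms) {M : Model S A}
    (hM : M ∈ updateModelSet (testSet Pi Ms F) φ N D) (h : Fin H) : misfit E π M h ≤ 2 * φ := by
  classical
  rw [updateModelSet, Finset.mem_filter] at hM
  have hMs := hN hM.1
  have hbdd : BddAbove ((fun f : S × A × S → ℝ =>
      (n : ℝ)⁻¹ * ∑ i : Fin n, sampleGap M f (D i h)) '' testSet Pi Ms F) := by
    refine ⟨2, ?_⟩
    rintro _ ⟨f, ⟨π', hπ', M', hM', h', hf⟩, rfl⟩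
    have hf1 : ∀ x, |f x| ≤ 1 := by
      have h1 := (hF π' hπ' M' hM' h').1
      rcases hf with rfl | rfl
      · exact h1
      · simpa using h1
    have hn' : (0 : ℝ) < n := by exact_mod_cast hn
    simp only
    rw [inv_mul_le_iff₀ hn']
    calc ∑ i, sampleGap M f (D i h) ≤ ∑ _i : Fin n, (2 : ℝ) :=
          Finset.sum_le_sum fun i _ => (abs_le.1 (abs_sampleGap_le M hf1 _)).2
      _ = n * 2 := by simp
  have h1 : (n : ℝ)⁻¹ * ∑ i : Fin n, sampleGap M (F π M h) (D i h) ≤ φ :=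
    (le_csSup hbdd ⟨F π M h, ⟨π, hπ, M, hMs, h, Or.inl rfl⟩, rfl⟩).trans (hM.2 h)
  -- Accuracy is one-sided; applied to the negated test function it bounds the true gap by the
  -- empirical one plus `φ`, that is by `2 φ`.
  have h2 := sum_sampleGap_le hD hn hMs h (f := -F π M h) ⟨π, hπ, M, hMs, h, Or.inr rfl⟩
  have h3 : ∀ x, sampleGap M (-F π M h) x = -sampleGap M (F π M h) x := by
    intro x
    simp only [sampleGap, _root_.Pi.neg_apply, mul_neg, tsum_neg]
    ring
  simp only [h3, Finset.sum_neg_distrib, mul_neg, testGap_neg] at h2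
  have h4 := misfit_le_testGap hF hπ hMs h
  linarith

/-- If no policy finds much disagreement in the current model set, then acting optimally for any
of its models is nearly optimal. -/
theorem value_sub_le_of_vExplore_le [Nonempty A] {E : Env S A} {H : ℕ} {Pi : Finset (Policy S A)}
    {N : Finset (Model S A)} {ε : ℝ} (hstar : E.Mstar ∈ N)
    (hopt : ∃ π ∈ Pi, IsOptimal E H E.Mstar π)
    (hv : ∀ π ∈ Pi, vExplore E H π N ≤ ε / Fintype.card A) {M : Model S A} (hM : M ∈ N)
    {π : Policy S A} (hπ : π ∈ Pi) (hmax : ∀ π' ∈ Pi, value E H M π' ≤ value E H M π)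
    (π' : Policy S A) : value E H E.Mstar π' - ε ≤ value E H E.Mstar π := by
  have hA : (0 : ℝ) < Fintype.card A := by exact_mod_cast Fintype.card_pos
  -- The values differ by at most `|𝒜| / 2` times the disagreement, which is at most `ε / |𝒜|`. The
  -- bound is used twice, for the returned policy and for an optimal one.
  have key : ∀ ρ ∈ Pi, |value E H M ρ - value E H E.Mstar ρ| ≤ ε / 2 := by
    intro ρ hρ
    refine (abs_value_sub_le E H M E.Mstar ρ).trans ?_
    have h1 := (sum_disagreement_le_vExplore E H ρ hM hstar).trans (hv ρ hρ)
    rw [le_div_iff₀ hA] at h1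
    linarith
  obtain ⟨ρ, hρ, hρopt⟩ := hopt
  have h1 := abs_le.1 (key ρ hρ)
  have h2 := abs_le.1 (key π hπ)
  have h3 := hmax ρ hρ
  have h4 := hρopt π'
  linarith [h1.1, h2.2]

/-- Here `log 6 ≥ 3 log (5/3)` gives `T ≥ 3 H`, so the fourth power of `T m p / δ` absorbs the
factor `H²` of the union bound, which does not occur in the logarithm, and the `T + 1` iterations as
well. -/
theorem failure_bound {H m p d : ℕ} {T δ x y : ℝ} (hH : 0 < H) (hm : 0 < m) (hp : 0 < p)
    (hd : 0 < d) (hδ : 0 < δ) (hδ1 : δ ≤ 1) (hx : Real.log 6 ≤ x)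
    (hT : T = H * d * x / Real.log (5 / 3)) (hy : 4 * Real.log (T * m * p / δ) ≤ y) :
    0 < Real.log (T * m * p / δ) ∧
      2 * (H : ℝ) ^ 2 * (m : ℝ) ^ 2 * p * Real.exp (-y) ≤ δ / (T + 1) := by
  have hH1 : (1 : ℝ) ≤ H := by exact_mod_cast hH
  have hm1 : (1 : ℝ) ≤ m := by exact_mod_cast hm
  have hp1 : (1 : ℝ) ≤ p := by exact_mod_cast hp
  have hd1 : (1 : ℝ) ≤ d := by exact_mod_cast hd
  have hlog : 0 < Real.log (5 / 3) := Real.log_pos (by norm_num)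
  have hlog6 : 3 * Real.log (5 / 3) ≤ Real.log 6 := by
    have : (3 : ℝ) * Real.log (5 / 3) = Real.log ((5 / 3) ^ 3) := by rw [Real.log_pow]; norm_num
    rw [this]
    exact Real.log_le_log (by norm_num) (by norm_num)
  have hTH : 3 * H ≤ T := by
    rw [hT, le_div_iff₀ hlog]
    have h1 : 3 * Real.log (5 / 3) ≤ d * x := by nlinarith
    nlinarith
  have hT3 : 3 ≤ T := by linarith
  set z := T * m * p / δ with hz
  have hz3 : 3 ≤ z := by
    rw [hz, le_div_iff₀ hδ]
    have h1 : T ≤ T * m * p := by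
      rw [mul_assoc]
      exact le_mul_of_one_le_right (by linarith) (one_le_mul_of_one_le_of_one_le hm1 hp1)
    nlinarith
  refine ⟨Real.log_pos (by linarith), ?_⟩
  have hexp : Real.exp (-y) ≤ (z ^ 4)⁻¹ := by
    rw [Real.exp_neg]
    apply inv_anti₀ (by positivity)
    rw [← Real.exp_log (show 0 < z by linarith), ← Real.exp_nat_mul]
    exact Real.exp_le_exp.2 (by exact_mod_cast hy)
  have hpoly : 2 * (H : ℝ) ^ 2 * (T + 1) ≤ T ^ 4 := by
    have h1 : (H : ℝ) ^ 2 ≤ (T / 3) ^ 2 := by gcongr; linarith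
    calc 2 * (H : ℝ) ^ 2 * (T + 1) ≤ 2 * (T / 3) ^ 2 * (T + T) := by gcongr; linarith
      _ = 4 / 9 * T ^ 3 := by ring
      _ ≤ T * T ^ 3 := by gcongr; linarith
      _ = T ^ 4 := by ring
  calc 2 * (H : ℝ) ^ 2 * (m : ℝ) ^ 2 * p * Real.exp (-y)
      ≤ 2 * (H : ℝ) ^ 2 * (m : ℝ) ^ 2 * p * (z ^ 4)⁻¹ := by gcongr
    _ ≤ δ / (T + 1) := by
      rw [← div_eq_mul_inv, div_le_div_iff₀ (by positivity) (by linarith)]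
      have hzz : δ * z ^ 4 = T ^ 4 * m ^ 4 * p ^ 4 * (δ ^ 3)⁻¹ := by
        rw [hz]; field_simp
      rw [hzz]
      calc 2 * (H : ℝ) ^ 2 * (m : ℝ) ^ 2 * p * (T + 1)
          = (2 * (H : ℝ) ^ 2 * (T + 1)) * (m : ℝ) ^ 2 * (p : ℝ) ^ 1 * 1 := by ring
        _ ≤ T ^ 4 * (m : ℝ) ^ 4 * (p : ℝ) ^ 4 * (δ ^ 3)⁻¹ := by
          gcongr
          · norm_num
          · norm_num
          · exact (one_le_inv₀ (by positivity)).2 (pow_le_one₀ hδ.le hδ1)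

end DREEM

/-! ### The invariant along a run of the algorithm -/

namespace DREEM

open scoped ENNReal

universe u v

variable {S : Type u} {A : Type v} [Fintype A]

/-- What holds after `k` iterations as long as all data sets have been accurate: the algorithm has
halted with a buffer and a policy that satisfy `G`, or it has explored `k` times, has not eliminated
the true model, and has a history of witnesses. -/
def Invariant (E : Env S A) {H n : ℕ} (Pi : Finset (Policy S A)) (Ms : Finset (Model S A))
    (η w : ℝ) (G : Buffer S A H n → Policy S A → Prop) (k : ℕ) : State S A H n → Prop
  | .running b N => b.length = k ∧ N ⊆ Ms ∧ E.Mstar ∈ N ∧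
      ∃ l : List (Pi × Ms × Fin H), l.length = k ∧ IsHistory E Pi Ms η w N l
  | .halted b π => G b π

/-- The new witness model still belongs to the current set, so `small` already bounds its misfit
under all earlier policies. -/
theorem IsHistory.cons {E : Env S A} {H : ℕ} {Pi : Finset (Policy S A)} {Ms : Finset (Model S A)}
    {η w : ℝ} {N N' : Finset (Model S A)} {l : List (Pi × Ms × Fin H)}
    (hl : IsHistory E Pi Ms η w N l) {x : Pi × Ms × Fin H} (hx : x.2.1.1 ∈ N)
    (hwide : w < misfit E x.1 x.2.1 x.2.2) (hsub : N' ⊆ N)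
    (hsmall : ∀ M ∈ N', ∀ h : Fin H, misfit E x.1 M h ≤ η) :
    IsHistory E Pi Ms η w N' (x :: l) where
  wide := by
    rintro y hy
    rcases List.mem_cons.1 hy with rfl | hy
    · exact hwide
    · exact hl.wide y hy
  pairwise := List.pairwise_cons.2 ⟨fun y hy => hl.small y hy _ hx, hl.pairwise⟩
  small := by
    rintro y hy M hM
    rcases List.mem_cons.1 hy with rfl | hy
    · exact hsmall M hM
    · exact hl.small y hy M (hsub hM)

/-- One iteration preserves the invariant up to the failure probability of one data set. -/
theorem toOuterMeasure_step_invariant_le [Nonempty A] {E : Env S A} {H n : ℕ} (hH : 0 < H)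
    {Pi : Finset (Policy S A)} {Ms : Finset (Model S A)} (hstar : E.Mstar ∈ Ms)
    {F : Policy S A → Model S A → Fin H → S × A × S → ℝ} (hF : IsTestFamily E H Pi Ms F)
    {τ : Policy S A → PMF (Trajectory S A H)} {P : Planner S A H n} (hP : P.IsExact E Pi Ms)
    {ε φ w : ℝ} (hφ : 0 ≤ φ) (hw : w = ε / (2 * (H : ℝ) ^ 2 * (Fintype.card A : ℝ) ^ 2))
    {G : Buffer S A H n → Policy S A → Prop} {r : ℝ≥0∞}
    (hr : ∀ π ∈ Pi, ∀ M ∈ Ms, ∀ h : Fin H, w < misfit E π M h → 0 < n ∧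
      (iid (τ π) n).toOuterMeasure {D | ¬ IsAccurate E Ms (testSet Pi Ms F) φ π D} ≤ r)
    (hG : ∀ b N, ∀ l : List (Pi × Ms × Fin H), l.length = b.length → N ⊆ Ms → E.Mstar ∈ N →
      IsHistory E Pi Ms (2 * φ) w N l →
      vExplore E H (P.explore b N) N ≤ ε / Fintype.card A → G b (P.exploit b (P.choose b N)))
    (k : ℕ) (x : State S A H n) (hx : Invariant E Pi Ms (2 * φ) w G k x) :
    (step E τ (testSet Pi Ms F) P ε φ x).toOuterMeasure
      {y | Invariant E Pi Ms (2 * φ) w G (k + 1) y}ᶜ ≤ r := by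
  classical
  have hpure : ∀ y : State S A H n, Invariant E Pi Ms (2 * φ) w G (k + 1) y →
      (PMF.pure y).toOuterMeasure {y | Invariant E Pi Ms (2 * φ) w G (k + 1) y}ᶜ ≤ r := by
    intro y hy
    rw [PMF.toOuterMeasure_pure_apply, if_neg (by simpa using hy)]
    exact zero_le
  rcases x with ⟨b, N⟩ | ⟨b, π⟩
  · obtain ⟨hb, hN, hNstar, l, hlk, hl⟩ := hx
    have hne : N.Nonempty := ⟨_, hNstar⟩
    rw [step, if_pos hne]
    split_ifs with hexp
    · have hπ := hP.explore_mem b N hN hne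
      set π := P.explore b N
      obtain ⟨M, hM, h, hlt⟩ := exists_lt_misfit E hH π hne hexp
      rw [← hw] at hlt
      obtain ⟨hn, hacc⟩ := hr π hπ M (hN hM) h hlt
      rw [PMF.toOuterMeasure_map_apply]
      refine le_trans (MeasureTheory.measure_mono ?_) hacc
      intro D hD
      rw [Set.mem_ofPred_eq]
      intro hDacc
      refine hD ?_
      refine ⟨by simp [hb], (updateModelSet_subset _ _ _ _).trans hN,
        Mstar_mem_updateModelSet hφ hDacc hn hstar hNstar,
        (⟨π, hπ⟩, ⟨M, hN hM⟩, h) :: l, by simp [hlk], ?_⟩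
      exact hl.cons hM hlt (updateModelSet_subset _ _ _ _) fun M' hM' h' =>
        misfit_le_of_mem_updateModelSet hF hπ hDacc hn hN hM' h'
    · exact hpure _ (hG b N l (hlk.trans hb.symm) hN hNstar hl (not_lt.1 hexp))
  · exact hpure _ hx

theorem toOuterMeasure_run_invariant_le {E : Env S A} {H n : ℕ}
    {Pi : Finset (Policy S A)} {Ms : Finset (Model S A)} (hstar : E.Mstar ∈ Ms)
    {Ft : Set (S × A × S → ℝ)} {τ : Policy S A → PMF (Trajectory S A H)} {P : Planner S A H n}
    {ε φ η w : ℝ} {G : Buffer S A H n → Policy S A → Prop} {r : ℝ≥0∞}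
    (hstep : ∀ k x, Invariant E Pi Ms η w G k x →
      (step E τ Ft P ε φ x).toOuterMeasure {y | Invariant E Pi Ms η w G (k + 1) y}ᶜ ≤ r)
    (k : ℕ) :
    (run E τ Ft P ε φ Ms k).toOuterMeasure {y | Invariant E Pi Ms η w G k y}ᶜ ≤ k * r := by
  induction k with
  | zero =>
    have h0 : Invariant E Pi Ms η w G 0 (.running [] Ms : State S A H n) :=
      ⟨rfl, subset_rfl, hstar, [], rfl, ⟨by simp, by simp, by simp⟩⟩
    rw [run, PMF.toOuterMeasure_pure_apply, if_neg (by simpa using h0)]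
    exact zero_le
  | succ k ih =>
    rw [run]
    refine (toOuterMeasure_bind_compl_le _ _ {y | Invariant E Pi Ms η w G k y} _ r
      fun x hx => hstep k x hx).trans ?_
    rw [Nat.cast_succ, add_mul, one_mul]
    gcongr

/-- A running state that satisfies the invariant after `K` iterations would carry a history of
length `K`, which is too long; the invariant therefore forces a halt with `G`. -/
theorem one_sub_le_haltProb {E : Env S A} {H n : ℕ}
    {Pi : Finset (Policy S A)} {Ms : Finset (Model S A)} (hstar : E.Mstar ∈ Ms)
    {Ft : Set (S × A × S → ℝ)} {τ : Policy S A → PMF (Trajectory S A H)} {P : Planner S A H n}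
    {ε φ η w : ℝ} {G : Buffer S A H n → Policy S A → Prop} {r : ℝ≥0∞}
    (hstep : ∀ k x, Invariant E Pi Ms η w G k x →
      (step E τ Ft P ε φ x).toOuterMeasure {y | Invariant E Pi Ms η w G (k + 1) y}ᶜ ≤ r)
    {K : ℕ} (hK : ∀ N, ∀ l : List (Pi × Ms × Fin H), IsHistory E Pi Ms η w N l → l.length < K) :
    1 - K * r ≤ haltProb E τ Ft P ε φ Ms G := by
  refine le_trans ?_ (le_iSup _ K)
  rw [tsub_le_iff_right]
  refine (one_le_toOuterMeasure_add_compl (run E τ Ft P ε φ Ms K)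
    {y | Invariant E Pi Ms η w G K y}).trans ?_
  refine add_le_add (MeasureTheory.measure_mono ?_) (toOuterMeasure_run_invariant_le hstar hstep K)
  rintro (⟨b, N⟩ | ⟨b, π⟩) hx
  · obtain ⟨-, -, -, l, hl, hhist⟩ := hx
    exact absurd (hK N l hhist) (by omega)
  · exact ⟨b, π, rfl, hx⟩

end DREEM

/-! ### Choice of constants and conclusion -/

theorem theorem1 :
    ∃ c : ℝ, 0 < c ∧ ∀ C : ℝ, c ≤ C → ∃ C' : ℝ, 0 < C' ∧
      ∀ (S : Type*) (A : Type*) [Fintype A] [Nonempty A] (E : DREEM.Env S A) (H : ℕ)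
        (Ms : Finset (DREEM.Model S A)) (Pi : Finset (DREEM.Policy S A))
        (_ : E.Mstar ∈ Ms) (_ : ∀ M ∈ Ms, ∃ π ∈ Pi, DREEM.IsOptimal E H M π)
        (β : ℝ) (d : ℕ)
        (_ : (⨆ h : Fin H, DREEM.normRank (DREEM.misfitMatrix E Pi Ms h) β) = (d : ℕ∞))
        (ε δ : ℝ) (_ : 0 < ε) (_ : ε ≤ 1) (_ : 0 < δ) (_ : δ ≤ 1)
        (φ T : ℝ) (_ : φ = DREEM.threshold H (Fintype.card A) d ε)
        (_ : T = DREEM.roundBound H (Fintype.card A) d ε β) (_ : 0 < T)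
        (n : ℕ)
        (_ : c * ((H : ℝ) ^ 4 * (Fintype.card A : ℝ) ^ 4 * d *
          Real.log (T * Ms.card * Pi.card / δ) / ε ^ 2) ≤ n)
        (_ : (n : ℝ) ≤ C * ((H : ℝ) ^ 4 * (Fintype.card A : ℝ) ^ 4 * d *
          Real.log (T * Ms.card * Pi.card / δ) / ε ^ 2))
        (τ : DREEM.Policy S A → PMF (DREEM.Trajectory S A H))
        (_ : DREEM.IsTrajectoryLaw E H τ)
        (F : DREEM.Policy S A → DREEM.Model S A → Fin H → S × A × S → ℝ)
        (_ : DREEM.IsTestFamily E H Pi Ms F)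
        (P : DREEM.Planner S A H n) (_ : P.IsExact E Pi Ms),
        ENNReal.ofReal (1 - δ) ≤
          DREEM.haltProb E τ (DREEM.testSet Pi Ms F) P ε φ Ms fun b π =>
            (∀ π' : DREEM.Policy S A,
              DREEM.value E H E.Mstar π' - ε ≤ DREEM.value E H E.Mstar π) ∧
            (DREEM.numTrajectories b : ℝ) ≤
              C' * ((H : ℝ) ^ 5 * (d : ℝ) ^ 2 * (Fintype.card A : ℝ) ^ 4 / ε ^ 2 *
                Real.log (T * Ms.card * Pi.card / δ) * Real.log (β / (2 * φ))) := by
  have hlog53 : 0 < Real.log (5 / 3) := Real.log_pos (by norm_num)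
  -- Here `18432 = 32 · 576`, where `576 = 24²` comes from `φ²`; then `n φ² / 8` is at least four
  -- times the logarithm, as `failure_bound` asks. The second constant comes from multiplying the
  -- upper bound on `n` by `T`.
  refine ⟨18432, by norm_num, fun C hC => ⟨C / Real.log (5 / 3), by positivity, ?_⟩⟩
  intro S A _ _ E H Ms Pi hstar hopt β d hrank ε δ hε _ hδ hδ1 φ T hφ hT hTpos n hn hnC τ hτ F hF
    P hP
  have hC0 : 0 < C := by linarith
  rw [DREEM.roundBound, ← hφ] at hT
  have hH : 0 < H := by
    rcases Nat.eq_zero_or_pos H with h | h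
    · simp [hT, h] at hTpos
    · exact h
  have hd : 0 < d := by
    rcases Nat.eq_zero_or_pos d with h | h
    · simp [hT, h] at hTpos
    · exact h
  have hH0 : (0 : ℝ) < H := by exact_mod_cast hH
  have hd0 : (0 : ℝ) < d := by exact_mod_cast hd
  have hA0 : (0 : ℝ) < Fintype.card A := by exact_mod_cast Fintype.card_pos
  have hφ0 : 0 < φ := by
    rw [hφ, DREEM.threshold]
    positivity
  have hlogβ : 0 < Real.log (β / (2 * φ)) := by
    have h1 : 0 < (H : ℝ) * d * Real.log (β / (2 * φ)) := by
      rw [hT] at hTpos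
      exact (div_pos_iff_of_pos_right hlog53).1 hTpos
    exact pos_of_mul_pos_right h1 (by positivity)
  have hw : 6 * (2 * φ) * √(d : ℝ) = ε / (2 * (H : ℝ) ^ 2 * (Fintype.card A : ℝ) ^ 2) := by
    rw [hφ, DREEM.threshold]
    have : 0 < √(d : ℝ) := Real.sqrt_pos.2 hd0
    field_simp
    norm_num
  have hnφ : 32 * Real.log (T * Ms.card * Pi.card / δ) ≤ n * φ ^ 2 := by
    have h1 : φ ^ 2 = ε ^ 2 / (576 * ((H : ℝ) ^ 4 * (Fintype.card A : ℝ) ^ 4 * d)) := by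
      rw [hφ, DREEM.threshold, div_pow, mul_pow, Real.sq_sqrt hd0.le]
      ring
    calc 32 * Real.log (T * Ms.card * Pi.card / δ)
        = 18432 * ((H : ℝ) ^ 4 * (Fintype.card A : ℝ) ^ 4 * d *
          Real.log (T * Ms.card * Pi.card / δ) / ε ^ 2) * φ ^ 2 := by
          rw [h1]; field_simp; ring
      _ ≤ n * φ ^ 2 := by gcongr
  have hlen : ∀ N, ∀ l : List (Pi × Ms × Fin H),
      DREEM.IsHistory E Pi Ms (2 * φ) (6 * (2 * φ) * √(d : ℝ)) N l → (l.length : ℝ) ≤ T := by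
    intro N l hl
    have h1 := hl.length_le hrank hd (by positivity) hlogβ.le
    -- Halving the volume with each cut is better than the rate `5/3` built into `T`.
    have h2 : Real.log (5 / 3) ≤ Real.log 2 := Real.log_le_log (by norm_num) (by norm_num)
    rw [hT, le_div_iff₀ hlog53]
    exact le_trans (by gcongr) h1
  have hPi : 0 < Pi.card := by
    obtain ⟨π, hπ, -⟩ := hopt _ hstar
    exact Finset.card_pos.2 ⟨π, hπ⟩
  have hMs : 0 < Ms.card := Finset.card_pos.2 ⟨_, hstar⟩
  have hstep := DREEM.toOuterMeasure_step_invariant_le (τ := τ)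
    (r := ENNReal.ofReal (δ / (T + 1))) (G := fun b π =>
      (∀ π' : DREEM.Policy S A, DREEM.value E H E.Mstar π' - ε ≤ DREEM.value E H E.Mstar π) ∧
      (DREEM.numTrajectories b : ℝ) ≤ C / Real.log (5 / 3) *
        ((H : ℝ) ^ 5 * (d : ℝ) ^ 2 * (Fintype.card A : ℝ) ^ 4 / ε ^ 2 *
          Real.log (T * Ms.card * Pi.card / δ) * Real.log (β / (2 * φ))))
    hH hstar hF hP hφ0.le hw
    (by
      intro π hπ M hM h hlt
      -- In a round that explores, some misfit exceeds `12 φ √d`, while `β` bounds every misfit.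
      -- Without such a misfit no data are collected, and nothing about `n` is needed.
      have hβ : Real.log 6 ≤ Real.log (β / (2 * φ)) := by
        refine Real.log_le_log (by norm_num) ?_
        rw [le_div_iff₀ (by positivity)]
        have h1 : 1 ≤ √(d : ℝ) := Real.one_le_sqrt.2 (by exact_mod_cast hd)
        calc 6 * (2 * φ) ≤ 6 * (2 * φ) * √(d : ℝ) :=
              le_mul_of_one_le_right (by positivity) h1
          _ ≤ β := hlt.le.trans (DREEM.misfit_le_of_normRank hrank hπ hM h)
      obtain ⟨hL, hfail⟩ := DREEM.failure_bound (y := n * φ ^ 2 / 8) hH hMs hPi hd hδ hδ1 hβ hT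
        (by linarith)
      refine ⟨?_, (DREEM.toOuterMeasure_not_isAccurate_le hF hτ π n hφ0).trans
        (ENNReal.ofReal_le_ofReal hfail)⟩
      have : (0 : ℝ) < n := lt_of_lt_of_le (by positivity) hn
      exact_mod_cast this)
    (by
      intro b N l hl hN hNstar hhist hexp
      have hne : N.Nonempty := ⟨_, hNstar⟩
      have hchoose := hP.choose_mem b N hN hne
      refine ⟨DREEM.value_sub_le_of_vExplore_le hNstar (hopt _ hstar)
        (fun π hπ => (hP.explore_max b N hN hne π hπ).trans hexp) hchoose
        (hP.exploit_mem b _ (hN hchoose)) (hP.exploit_max b _ (hN hchoose)), ?_⟩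
      have hbT : (b.length : ℝ) ≤ T := by
        rw [← hl]
        exact hlen N l hhist
      rw [DREEM.numTrajectories, Nat.cast_mul]
      calc (n : ℝ) * b.length ≤ n * T := by gcongr
        _ ≤ C * ((H : ℝ) ^ 4 * (Fintype.card A : ℝ) ^ 4 * d *
          Real.log (T * Ms.card * Pi.card / δ) / ε ^ 2) * T := by gcongr
        _ = C * ((H : ℝ) ^ 4 * (Fintype.card A : ℝ) ^ 4 * d *
          Real.log (T * Ms.card * Pi.card / δ) / ε ^ 2) *
            (H * d * Real.log (β / (2 * φ)) / Real.log (5 / 3)) := by rw [← hT]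
        _ = _ := by ring)
  -- At most `⌊T⌋` explorations, plus one iteration in which to halt; each fails with probability at
  -- most `δ / (T + 1)`.
  refine le_trans ?_ (DREEM.one_sub_le_haltProb hstar hstep (K := ⌊T⌋₊ + 1) fun N l hl =>
    Nat.lt_succ_of_le (Nat.le_floor (hlen N l hl)))
  rw [ENNReal.ofReal_sub _ hδ.le, ENNReal.ofReal_one]
  refine tsub_le_tsub_left ?_ _
  rw [← ENNReal.ofReal_natCast, ← ENNReal.ofReal_mul (by positivity)]
  refine ENNReal.ofReal_le_ofReal ?_
  have h1 : ((⌊T⌋₊ + 1 : ℕ) : ℝ) ≤ T + 1 := by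
    push_cast
    linarith [Nat.floor_le hTpos.le]
  calc ((⌊T⌋₊ + 1 : ℕ) : ℝ) * (δ / (T + 1)) ≤ (T + 1) * (δ / (T + 1)) := by gcongr
    _ = δ := by field_simp
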